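/- Let $N\ge 0$ be an integer, $z_1,\dots,z_N\in\mathbb C$ pairwise distinct, and $\lambda_1,\dots,\lambda_N\in\mathbb Z_{\ge 0}$. Let $V_\lambda$ denote the irreducible $\mathfrak{sl}_2(\mathbb C)$-module of highest weight $\lambda$ (of dimension $\lambda+1$), let $e,h,f$ be the standard basis of $\mathfrak{sl}_2$, and for $a\in\mathfrak{sl}_2$ let $a^{(i)}$ be the operator on $\bigotimes_{j=1}^N V_{\lambda_j}$ that acts as $a$ on the $i$-th factor and as the identity on the others. The Gaudin Hamiltonians are $$H_i=\sum_{j\neq i}\frac{e^{(i)}f^{(j)}+f^{(i)}e^{(j)}+\tfrac12 h^{(i)}h^{(j)}}{z_i-z_j},\qquad i=1,\dots,N.$$ Suppose that there are a non-zero vector $\Psi\in\bigotimes_{i=1}^N V_{\lambda_i}$ and numbers $\mu_1,\dots,\mu_N\in\mathbb C$ with $H_i\Psi=\mu_i\Psi$ for all $i$. Put $$q(t)=\sum_{i=1}^N\frac{\lambda_i(\lambda_i+2)/4}{(t-z_i)^2}+\sum_{i=1}^N\frac{\mu_i}{t-z_i}.$$ Then all solutions of the differential equation $(\partial_t^2-q(t))\phi=0$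 have monodromy $\pm1$ around each of the points $z_1,\dots,z_N$ and $\infty$: for each of these points there is a sign $\varepsilon\in\{1,-1\}$ such that every germ of a holomorphic solution at the base point of a circle around that point, which separates it from the other points of $\{z_1,\dots,z_N,\infty\}$, can be continued analytically along the circle, and the continuation multiplies it by $\varepsilon$. Consequently the monodromy representation $\pi_1(\mathbb P^1\setminus\{z_1,\dots,z_N,\infty\},a)\to PGL_2(\mathbb C)$ of the projective connection $\partial_t^2-q(t)$, given by analytic continuation of a basis of the two-dimensional space of germs of solutions at the base point $a$, is trivial for every $a$. -/

import Mathlib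

noncomputable section

namespace Gaudin

open Polynomial
open scoped Topology

/-! ### The irreducible `sl₂`-modules -/

/-- The irreducible `sl₂`-module `V_m` of highest weight `m`, realized on polynomials of degree at
most `m` in one variable `x`, with
`e = -x² d/dx + m x`, `h = 2 x d/dx - m`, `f = d/dx`. -/
abbrev V (m : ℕ) : Type := degreeLT ℂ (m + 1)

/-- `-x² d/dx + m x` on all polynomials. -/
def ePoly (m : ℕ) : ℂ[X] →ₗ[ℂ] ℂ[X] :=
  (m : ℂ) • LinearMap.mulLeft ℂ X - LinearMap.mulLeft ℂ (X ^ 2) ∘ₗ derivative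

/-- `2 x d/dx - m` on all polynomials. -/
def hPoly (m : ℕ) : ℂ[X] →ₗ[ℂ] ℂ[X] :=
  (2 : ℂ) • (LinearMap.mulLeft ℂ X ∘ₗ derivative) - (m : ℂ) • LinearMap.id

lemma ePoly_coeff_zero (m : ℕ) (p : ℂ[X]) : (ePoly m p).coeff 0 = 0 := by
  simp [ePoly, pow_two]

lemma ePoly_coeff_succ (m n : ℕ) (p : ℂ[X]) :
    (ePoly m p).coeff (n + 1) = ((m : ℂ) - n) * p.coeff n := by
  rcases n with _ | n
  · simp [ePoly, pow_two, coeff_X_mul]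
  · simp [ePoly, pow_two, coeff_X_mul, coeff_derivative]
    ring

lemma hPoly_coeff (m n : ℕ) (p : ℂ[X]) :
    (hPoly m p).coeff n = (2 * (n : ℂ) - m) * p.coeff n := by
  rcases n with _ | n
  · simp [hPoly]
  · simp [hPoly, coeff_X_mul, coeff_derivative]
    ring

lemma ePoly_mem (m : ℕ) (p : ℂ[X]) (hp : p ∈ degreeLT ℂ (m + 1)) :
    ePoly m p ∈ degreeLT ℂ (m + 1) := by
  rw [mem_degreeLT, degree_lt_iff_coeff_zero] at *
  intro n hn
  obtain ⟨n, rfl⟩ : ∃ k, n = k + 1 := ⟨n - 1, by omega⟩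
  rw [ePoly_coeff_succ]
  rcases eq_or_ne n m with rfl | h
  · simp
  · rw [hp n (by omega), mul_zero]

lemma hPoly_mem (m : ℕ) (p : ℂ[X]) (hp : p ∈ degreeLT ℂ (m + 1)) :
    hPoly m p ∈ degreeLT ℂ (m + 1) := by
  rw [mem_degreeLT, degree_lt_iff_coeff_zero] at *
  intro n hn
  rw [hPoly_coeff, hp n hn, mul_zero]

lemma derivative_mem (m : ℕ) (p : ℂ[X]) (hp : p ∈ degreeLT ℂ (m + 1)) :
    derivative p ∈ degreeLT ℂ (m + 1) := by
  rw [mem_degreeLT, degree_lt_iff_coeff_zero] at *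
  intro n hn
  rw [coeff_derivative, hp (n + 1) (by omega), zero_mul]

/-- The action of `e` on `V_m`. -/
def eOp (m : ℕ) : Module.End ℂ (V m) := (ePoly m).restrict (ePoly_mem m)

/-- The action of `h` on `V_m`. -/
def hOp (m : ℕ) : Module.End ℂ (V m) := (hPoly m).restrict (hPoly_mem m)

/-- The action of `f` on `V_m`. -/
def fOp (m : ℕ) : Module.End ℂ (V m) :=
  (derivative : ℂ[X] →ₗ[ℂ] ℂ[X]).restrict (derivative_mem m)

/-- `[e, f] = h` on `V_m`. -/
lemma lie_eOp_fOp (m : ℕ) : ⁅eOp m, fOp m⁆ = hOp m := by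
  ext p n
  simp only [Ring.lie_def, LinearMap.sub_apply, Module.End.mul_apply, eOp, fOp, hOp,
    LinearMap.restrict_apply, AddSubgroupClass.coe_sub, coeff_sub, coeff_derivative,
    ePoly_coeff_succ, hPoly_coeff]
  rcases n with _ | n
  · simp [ePoly_coeff_zero]
  · simp only [ePoly_coeff_succ, coeff_derivative]
    push_cast
    ring

/-- `[h, e] = 2 e` on `V_m`. -/
lemma lie_hOp_eOp (m : ℕ) : ⁅hOp m, eOp m⁆ = (2 : ℂ) • eOp m := by
  ext p n
  simp only [Ring.lie_def, LinearMap.sub_apply, Module.End.mul_apply, eOp, hOp,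
    LinearMap.restrict_apply, AddSubgroupClass.coe_sub, coeff_sub, hPoly_coeff,
    LinearMap.smul_apply, SetLike.val_smul, coeff_smul, smul_eq_mul]
  rcases n with _ | n
  · simp [ePoly_coeff_zero]
  · simp only [ePoly_coeff_succ, hPoly_coeff]
    push_cast
    ring

/-- `[h, f] = -2 f` on `V_m`. -/
lemma lie_hOp_fOp (m : ℕ) : ⁅hOp m, fOp m⁆ = (-2 : ℂ) • fOp m := by
  ext p n
  simp only [Ring.lie_def, LinearMap.sub_apply, Module.End.mul_apply, fOp, hOp,
    LinearMap.restrict_apply, AddSubgroupClass.coe_sub, coeff_sub, hPoly_coeff,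
    coeff_derivative, LinearMap.smul_apply, SetLike.val_smul, coeff_smul, smul_eq_mul]
  push_cast
  ring

/-! ### The Gaudin Hamiltonians -/

/-- The space of states `⊗ᵢ V_{λᵢ}`. -/
abbrev States {N : ℕ} (lam : Fin N → ℕ) : Type := PiTensorProduct ℂ (fun i => V (lam i))

/-- `a⁽ⁱ⁾ = 1 ⊗ ⋯ ⊗ a ⊗ ⋯ ⊗ 1`, with `a` in the `i`-th place. -/
def site {N : ℕ} (lam : Fin N → ℕ) (i : Fin N) (a : Module.End ℂ (V (lam i))) :
    Module.End ℂ (States lam) :=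
  PiTensorProduct.map (Function.update (fun j => (LinearMap.id : V (lam j) →ₗ[ℂ] V (lam j))) i a)

/-- The Gaudin Hamiltonian
`Hᵢ = ∑_{j ≠ i} (e⁽ⁱ⁾ f⁽ʲ⁾ + f⁽ⁱ⁾ e⁽ʲ⁾ + ½ h⁽ⁱ⁾ h⁽ʲ⁾) / (zᵢ - zⱼ)` on `⊗ᵢ V_{λᵢ}`. -/
def hamiltonian {N : ℕ} (z : Fin N → ℂ) (lam : Fin N → ℕ) (i : Fin N) :
    Module.End ℂ (States lam) :=
  ∑ j ∈ Finset.univ.erase i, (z i - z j)⁻¹ •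
    (site lam i (eOp (lam i)) * site lam j (fOp (lam j))
      + site lam i (fOp (lam i)) * site lam j (eOp (lam j))
      + (1 / 2 : ℂ) • (site lam i (hOp (lam i)) * site lam j (hOp (lam j))))

/-! ### The differential equation and its monodromy -/

/-- `q(t) = ∑ᵢ (λᵢ(λᵢ+2)/4)/(t-zᵢ)² + ∑ᵢ μᵢ/(t-zᵢ)`. -/
def potential {N : ℕ} (z : Fin N → ℂ) (lam : Fin N → ℕ) (μ : Fin N → ℂ) (t : ℂ) : ℂ :=
  (∑ i, ((lam i : ℂ) * (lam i + 2) / 4) / (t - z i) ^ 2) + ∑ i, μ i / (t - z i)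

/-- `φ` is (a representative of the germ of) a holomorphic solution of `φ'' = q φ` near `a`. -/
def IsSolutionAt (q : ℂ → ℂ) (φ : ℂ → ℂ) (a : ℂ) : Prop :=
  AnalyticAt ℂ φ a ∧ ∀ᶠ t in 𝓝 a, deriv (deriv φ) t = q t * φ t

/-- The plane without the points `zᵢ`, that is, `ℙ¹ ∖ {z₁, …, z_N, ∞}`. -/
abbrev Punctured {N : ℕ} (z : Fin N → ℂ) : Type := {t : ℂ // ∀ i, t ≠ z i}

/-- `F` is an analytic continuation along the path `γ` of a solution of `φ'' = q φ`: for every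
time `s`, `F s` is a solution near `γ s`, and for `s'` close to `s` the functions `F s'` and `F s`
have the same germ at `γ s'`. -/
def IsContinuation {N : ℕ} {z : Fin N → ℂ} (q : ℂ → ℂ) {a b : Punctured z} (γ : Path a b)
    (F : unitInterval → ℂ → ℂ) : Prop :=
  (∀ s, IsSolutionAt q (F s) (γ s)) ∧ ∀ s, ∀ᶠ s' in 𝓝 s, F s' =ᶠ[𝓝 (γ s' : ℂ)] F s

/-- All solutions of `φ'' = q φ` have monodromy `c` along the loop `γ`: every germ of a solution
at the base point can be continued along `γ`, and any continuation ends with `c` times the germ it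
started from. -/
def HasScalarMonodromy {N : ℕ} {z : Fin N → ℂ} (q : ℂ → ℂ) {a : Punctured z} (γ : Path a a)
    (c : ℂ) : Prop :=
  ∀ φ : ℂ → ℂ, IsSolutionAt q φ a →
    (∃ F, IsContinuation q γ F ∧ F 0 =ᶠ[𝓝 (a : ℂ)] φ) ∧
    ∀ F, IsContinuation q γ F → F 0 =ᶠ[𝓝 (a : ℂ)] φ → F 1 =ᶠ[𝓝 (a : ℂ)] fun t => c * φ t

/-- `γ` runs once counterclockwise around the circle with centre `c` that starts at `c + w`. -/
def IsCircle {N : ℕ} {z : Fin N → ℂ} {a : Punctured z} (γ : Path a a) (c w : ℂ) : Prop :=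
  ∀ s, (γ s : ℂ) = c + w * Complex.exp (2 * Real.pi * Complex.I * ((s : ℝ) : ℂ))

/-- `γ` is a circle around `zᵢ`, with no other `zⱼ` inside or on it. -/
def IsLoopAround {N : ℕ} {z : Fin N → ℂ} (i : Fin N) {a : Punctured z} (γ : Path a a) : Prop :=
  ∃ w : ℂ, w ≠ 0 ∧ (∀ j, j ≠ i → ‖w‖ < ‖z j - z i‖) ∧ IsCircle γ (z i) w

/-- `γ` is a circle with all the `zⱼ` inside, traversed so as to run counterclockwise
around `∞`. -/
def IsLoopAroundInfty {N : ℕ} {z : Fin N → ℂ} {a : Punctured z} (γ : Path a a) : Prop :=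
  ∃ c w : ℂ, w ≠ 0 ∧ (∀ j, ‖z j - c‖ < ‖w‖) ∧ IsCircle γ.symm c w

/-- `(φ₀, φ₁)` is a basis of the space of germs at `a` of solutions of `φ'' = q φ`. -/
structure IsFundamentalSystem (q : ℂ → ℂ) (a : ℂ) (φ : Fin 2 → ℂ → ℂ) : Prop where
  isSolutionAt : ∀ k, IsSolutionAt q (φ k) a
  independent : ∀ c : Fin 2 → ℂ, (∀ᶠ t in 𝓝 a, ∑ k, c k * φ k t = 0) → c = 0
  spanning : ∀ ψ, IsSolutionAt q ψ a → ∃ c : Fin 2 → ℂ, ∀ᶠ t in 𝓝 a, ψ t = ∑ k, c k * φ k t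

/-- Continuation along the loop `γ` turns `φ_l` into `∑ₖ Mₖₗ φₖ`. -/
def IsMonodromyMatrix {N : ℕ} {z : Fin N → ℂ} (q : ℂ → ℂ) {a : Punctured z} (γ : Path a a)
    (φ : Fin 2 → ℂ → ℂ) (M : GL (Fin 2) ℂ) : Prop :=
  ∀ l, ∃ F, IsContinuation q γ F ∧ F 0 =ᶠ[𝓝 (a : ℂ)] φ l ∧
    F 1 =ᶠ[𝓝 (a : ℂ)] fun t => ∑ k, M.val k l * φ k t

/-- The group `PGL₂(ℂ)`. -/
abbrev PGL2 : Type := GL (Fin 2) ℂ ⧸ Subgroup.center (GL (Fin 2) ℂ)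

/-- `ρ` is the monodromy representation of the projective connection `∂² - q` with base point `a`,
written in the basis `φ` of the solutions near `a`: it sends the class of a loop to the class in
`PGL₂` of the monodromy matrix along that loop. -/
def IsProjectiveMonodromy {N : ℕ} {z : Fin N → ℂ} (q : ℂ → ℂ) (a : Punctured z)
    (φ : Fin 2 → ℂ → ℂ) (ρ : FundamentalGroup (Punctured z) a →* PGL2) : Prop :=
  ∀ γ : Path a a, ∃ M : GL (Fin 2) ℂ, IsMonodromyMatrix q γ φ M ∧
    ρ (FundamentalGroup.fromPath (Path.Homotopic.Quotient.mk γ)) = QuotientGroup.mk M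

end Gaudin

end

noncomputable section

namespace Gaudin

open Polynomial
open scoped Topology

/-! ### Operators acting at one site -/

section Site

variable {N : ℕ} (lam : Fin N → ℕ)

/-! Put `D = ∏ (t - zⱼ)` and `L = ∑ λⱼ/(t - zⱼ)`. Writing a solution as `φ = ∏ (t - zⱼ)^(-λⱼ/2) · g`
turns the equation into `D g'' = D L g' + B g` with `B` a polynomial (`potential_eq`,
`isSolutionAt_twist_mul`). This has exponents `0` and `λᵢ + 1` at `zᵢ`, so only a logarithm can give
`g` local monodromy. No logarithm occurs as soon as some polynomial `p` with `p(zᵢ) ≠ 0` satisfies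
the equation modulo `(t - zᵢ)^(λᵢ+1)`: the Frobenius recursion can then be continued past the
resonance (`exists_frobenius_solution`). If this holds at every `zᵢ`, each germ of `g` extends over
the whole loop and its interior (`extendsOn_square`), and continuing `φ` only changes the branch of
`∏ (t - zⱼ)^(-λⱼ/2)` (`hasScalarMonodromy_of_log`). The monodromy is therefore scalar along every
loop, hence trivial in `PGL₂`, and it is `±1` along the circles.

The polynomial `p` comes from an eigenvector by quantum separation of variables. Sending `e^k · 1`
to `X^k` at each site represents states by polynomials in `X₁, …, X_N`. There `f` and `h` are
differential operators, and `e` is multiplication by the variable up to monomials that are too high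
at some site (`highPart`). Substituting `Xⱼ = (t - zⱼ) ρⱼ` with `∑ ρⱼ = 0` turns a weighted sum of
all Hamiltonians into the single operator `D ∂² - D L ∂` (`separation_identity`). An eigenvector
thus gives a solution up to the image of `highPart`. Choosing `ρⱼ` free for `j ≠ i` and extracting
one coefficient in these free variables leaves only errors divisible by `(t - zᵢ)^(λᵢ+1)`.

It remains to ensure `p(zᵢ) ≠ 0`, which requires an eigenvector with a component along the lowest
weight vector at site `i`. The total lowering operator commutes with the Hamiltonians, so it
preserves the joint eigenspace, and a non-zero subspace with this property contains such a vector
(`exists_coeff_lift_ne_zero`). -/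

lemma site_tprod (i : Fin N) (a : Module.End ℂ (V (lam i))) (v : ∀ j, V (lam j)) :
    site lam i a (PiTensorProduct.tprod ℂ v)
      = PiTensorProduct.tprod ℂ (Function.update v i (a (v i))) := by
  rw [site, PiTensorProduct.map_tprod]
  congr 1
  funext j
  rcases eq_or_ne j i with rfl | h
  · simp
  · simp [h]

lemma site_mul (i : Fin N) (a b : Module.End ℂ (V (lam i))) :
    site lam i a * site lam i b = site lam i (a * b) := by
  ext v
  simp [site_tprod]

lemma site_comm {i j : Fin N} (hij : i ≠ j) (a : Module.End ℂ (V (lam i)))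
    (b : Module.End ℂ (V (lam j))) :
    site lam i a * site lam j b = site lam j b * site lam i a := by
  ext v
  simp [site_tprod, hij, hij.symm, Function.update_comm hij]

lemma site_add (i : Fin N) (a b : Module.End ℂ (V (lam i))) :
    site lam i (a + b) = site lam i a + site lam i b := by
  ext v
  simp [site_tprod, MultilinearMap.map_update_add]

lemma site_smul (i : Fin N) (c : ℂ) (a : Module.End ℂ (V (lam i))) :
    site lam i (c • a) = c • site lam i a := by
  ext v
  simp [site_tprod, MultilinearMap.map_update_smul]

/-- The sum of the operators `f⁽ʲ⁾` over all sites. -/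
def lowering : Module.End ℂ (States lam) := ∑ j, site lam j (fOp (lam j))

/-- The part `e⁽ⁱ⁾ f⁽ʲ⁾ + f⁽ⁱ⁾ e⁽ʲ⁾ + ½ h⁽ⁱ⁾ h⁽ʲ⁾` of the Hamiltonians. -/
def casimirPair (i j : Fin N) : Module.End ℂ (States lam) :=
  site lam i (eOp (lam i)) * site lam j (fOp (lam j))
    + site lam i (fOp (lam i)) * site lam j (eOp (lam j))
    + (1 / 2 : ℂ) • (site lam i (hOp (lam i)) * site lam j (hOp (lam j)))

/-- The pair operator is the polarized Casimir, invariant under the diagonal action at sites `i` and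
`j`; the lowering operators at all other sites commute with it because they act on different
factors. -/
lemma commute_lowering_casimirPair {i j : Fin N} (hij : i ≠ j) :
    Commute (lowering lam) (casimirPair lam i j) := by
  have hef : ∀ k, site lam k (eOp (lam k)) * site lam k (fOp (lam k))
      = site lam k (fOp (lam k)) * site lam k (eOp (lam k)) + site lam k (hOp (lam k)) := by
    intro k
    rw [← lie_eOp_fOp, Ring.lie_def, site_mul, site_mul, ← site_add, add_sub_cancel]
  have hfh : ∀ k, site lam k (fOp (lam k)) * site lam k (hOp (lam k))
      = site lam k (hOp (lam k)) * site lam k (fOp (lam k))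
        + (2 : ℂ) • site lam k (fOp (lam k)) := by
    intro k
    have h := lie_hOp_fOp (lam k)
    rw [Ring.lie_def, sub_eq_iff_eq_add] at h
    rw [site_mul, site_mul, h, ← site_smul, ← site_add]
    congr 1
    module
  have hfar : ∀ k, k ≠ i → k ≠ j →
      Commute (site lam k (fOp (lam k))) (casimirPair lam i j) := by
    intro k hki hkj
    have c1 : ∀ a b, Commute (site lam k (fOp (lam k))) (site lam i a * site lam j b) :=
      fun a b => Commute.mul_right (site_comm lam hki _ _) (site_comm lam hkj _ _)
    exact ((c1 _ _).add_right (c1 _ _)).add_right ((c1 _ _).smul_right _)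
  have hnear : Commute (site lam i (fOp (lam i)) + site lam j (fOp (lam j)))
      (casimirPair lam i j) := by
    have cij := fun a b => site_comm lam hij a b
    set ei := site lam i (eOp (lam i))
    set fi := site lam i (fOp (lam i)) with hfi
    set hi := site lam i (hOp (lam i))
    set ej := site lam j (eOp (lam j))
    set fj := site lam j (fOp (lam j)) with hfj
    set hj := site lam j (hOp (lam j))
    have e1 : ei * fi = fi * ei + hi := hef i
    have e2 : ej * fj = fj * ej + hj := hef j
    have e3 : fi * hi = hi * fi + (2 : ℂ) • fi := hfh i
    have e4 : fj * hj = hj * fj + (2 : ℂ) • fj := hfh j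
    have x1 : fj * ei = ei * fj := (cij _ _).symm
    have x2 : fj * fi = fi * fj := (cij _ _).symm
    have x3 : fj * hi = hi * fj := (cij _ _).symm
    have x4 : ej * fi = fi * ej := (cij _ _).symm
    have x5 : hj * fi = fi * hj := (cij _ _).symm
    -- The two mixed terms leave the defects `hi * fj` and `fi * hj`; the `hh` term leaves twice
    -- their sum with the opposite sign, which its factor `1/2` balances.
    have t1 : ei * fj * (fi + fj) = (fi + fj) * (ei * fj) + hi * fj := by
      calc ei * fj * (fi + fj) = (ei * fi) * fj + (ei * fj) * fj := by
            rw [mul_add, mul_assoc, x2, ← mul_assoc]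
        _ = _ := by
          rw [e1, add_mul, add_mul _ _ (ei * fj), mul_assoc fi, ← mul_assoc fj, x1]
          abel
    have t2 : fi * ej * (fi + fj) = (fi + fj) * (fi * ej) + fi * hj := by
      calc fi * ej * (fi + fj) = fi * (fi * ej) + fi * (ej * fj) := by
            rw [mul_add, mul_assoc, x4, mul_assoc]
        _ = _ := by
          rw [e2, mul_add, ← mul_assoc fi fj, ← x2, add_mul, mul_assoc fj, add_assoc]
    have t3 : (fi + fj) * (hi * hj)
        = hi * hj * (fi + fj) + (2 : ℂ) • (fi * hj) + (2 : ℂ) • (hi * fj) := by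
      calc (fi + fj) * (hi * hj) = (fi * hi) * hj + hi * (fj * hj) := by
            rw [add_mul, ← mul_assoc, ← mul_assoc fj, x3, mul_assoc hi]
        _ = _ := by
          rw [e3, e4, add_mul, mul_add, mul_add, mul_assoc hi fi, smul_mul_assoc,
            mul_smul_comm, mul_assoc, mul_assoc, x5]
          abel
    have : casimirPair lam i j = ei * fj + fi * ej + (1 / 2 : ℂ) • (hi * hj) := rfl
    rw [Commute, SemiconjBy, this, add_mul _ _ (fi + fj), add_mul _ _ (fi + fj), t1, t2,
      smul_mul_assoc, mul_add, mul_add, mul_smul_comm, t3, smul_add, smul_add, smul_smul, smul_smul]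
    norm_num
    abel
  rw [lowering, ← Finset.add_sum_erase _ _ (Finset.mem_univ i),
    ← Finset.add_sum_erase _ _ (Finset.mem_erase.mpr ⟨hij.symm, Finset.mem_univ j⟩), ← add_assoc]
  refine hnear.add_left (Commute.sum_left _ _ _ fun k hk => ?_)
  simp only [Finset.mem_erase] at hk
  exact hfar k hk.2.1 hk.1

lemma commute_lowering_hamiltonian (z : Fin N → ℂ) (i : Fin N) :
    Commute (lowering lam) (hamiltonian z lam i) := by
  refine Commute.sum_right _ _ _ fun j hj => Commute.smul_right ?_ _
  exact commute_lowering_casimirPair lam (Finset.ne_of_mem_erase hj).symm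

end Site

/-! ### Representing states by polynomials -/

section Lift

/-- The linear map `V_m → ℂ[X]` that sends `e^k · 1` to `X^k` for `k ≤ m`. -/
def liftV (m : ℕ) : V m →ₗ[ℂ] ℂ[X] where
  toFun v := ∑ k ∈ Finset.range (m + 1), monomial k ((v : ℂ[X]).coeff k / (m.descFactorial k : ℂ))
  map_add' v w := by simp [add_div, Finset.sum_add_distrib]
  map_smul' c v := by simp [Finset.smul_sum, mul_div_assoc, smul_monomial]

lemma coeff_V_eq_zero {m n : ℕ} (v : V m) (h : m < n) : (v : ℂ[X]).coeff n = 0 := by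
  have := v.2
  rw [mem_degreeLT, degree_lt_iff_coeff_zero] at this
  exact this n (by omega)

lemma coeff_liftV (m n : ℕ) (v : V m) :
    (liftV m v).coeff n = (v : ℂ[X]).coeff n / (m.descFactorial n : ℂ) := by
  simp only [liftV, LinearMap.coe_mk, AddHom.coe_mk, finsetSum_coeff, coeff_monomial]
  rw [Finset.sum_ite_eq']
  split_ifs with h
  · rfl
  · rw [coeff_V_eq_zero v (by simpa using h), zero_div]

lemma descFactorial_ne_zero {m n : ℕ} (h : n ≤ m) : (m.descFactorial n : ℂ) ≠ 0 := by
  exact_mod_cast (Nat.descFactorial_pos.mpr h).ne'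

lemma descFactorial_succ_cast {m n : ℕ} (h : n ≤ m) :
    (m.descFactorial (n + 1) : ℂ) = ((m : ℂ) - n) * m.descFactorial n := by
  rw [Nat.descFactorial_succ, Nat.cast_mul, Nat.cast_sub h]

/-- This expresses `f e^k · 1 = k (m - k + 1) e^(k-1) · 1`. -/
lemma liftV_fOp (m : ℕ) (v : V m) :
    liftV m (fOp m v) = C (m : ℂ) * derivative (liftV m v)
      - X * derivative (derivative (liftV m v)) := by
  ext n
  have hL : ((fOp m v : V m) : ℂ[X]) = derivative (v : ℂ[X]) := rfl
  have hR : (X * derivative (derivative (liftV m v))).coeff n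
      = n * ((n + 1) * (liftV m v).coeff (n + 1)) := by
    rcases n with _ | n
    · simp
    · simp only [coeff_X_mul, coeff_derivative]
      push_cast
      ring
  rw [coeff_sub, hR, coeff_C_mul, coeff_derivative, coeff_liftV, coeff_liftV, hL, coeff_derivative]
  rcases lt_or_ge n m with h | h
  · rw [descFactorial_succ_cast h.le]
    have h1 : (m : ℂ) - n ≠ 0 := sub_ne_zero.mpr (by exact_mod_cast h.ne')
    have h2 := descFactorial_ne_zero h.le
    field_simp
  · simp [coeff_V_eq_zero v (Nat.lt_succ_of_le h)]

lemma liftV_hOp (m : ℕ) (v : V m) :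
    liftV m (hOp m v) = C 2 * (X * derivative (liftV m v)) - C (m : ℂ) * liftV m v := by
  ext n
  have hL : ((hOp m v : V m) : ℂ[X]) = hPoly m v := rfl
  have hR : (X * derivative (liftV m v)).coeff n = n * (liftV m v).coeff n := by
    rcases n with _ | n
    · simp
    · simp only [coeff_X_mul, coeff_derivative]
      push_cast
      ring
  rw [coeff_sub, coeff_C_mul, hR, coeff_C_mul, coeff_liftV, coeff_liftV, hL, hPoly_coeff]
  ring

/-- Multiplication by `X` and `e` differ only on the highest weight vector, which `e` kills. -/
lemma liftV_eOp (m : ℕ) (v : V m) :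
    X * liftV m v - liftV m (eOp m v)
      = C ((v : ℂ[X]).coeff m / (m.descFactorial m : ℂ)) * X ^ (m + 1) := by
  ext n
  have hL : ((eOp m v : V m) : ℂ[X]) = ePoly m v := rfl
  rcases n with _ | n
  · rw [coeff_sub, coeff_liftV, hL, ePoly_coeff_zero]
    simp
  · rw [coeff_sub, coeff_X_mul, coeff_liftV, coeff_liftV, hL, ePoly_coeff_succ, coeff_C_mul,
      coeff_X_pow]
    rcases lt_trichotomy n m with h | rfl | h
    · rw [descFactorial_succ_cast h.le, if_neg (by omega)]
      have h1 : (m : ℂ) - n ≠ 0 := sub_ne_zero.mpr (by exact_mod_cast h.ne')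
      have h2 := descFactorial_ne_zero h.le
      field_simp
      ring
    · simp
    · rw [coeff_V_eq_zero v h, if_neg (by omega)]
      simp

variable {N : ℕ} (lam : Fin N → ℕ)

/-- The linear map from states to polynomials in `X₁, …, X_N` that sends
`∏ⱼ (e⁽ʲ⁾)^{kⱼ} · 1` to `∏ⱼ Xⱼ^{kⱼ}` for `kⱼ ≤ λⱼ`. -/
def lift : States lam →ₗ[ℂ] MvPolynomial (Fin N) ℂ :=
  PiTensorProduct.lift ((MultilinearMap.mkPiAlgebra ℂ (Fin N) (MvPolynomial (Fin N) ℂ)).compLinearMap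
    fun j => (Polynomial.aeval (MvPolynomial.X j : MvPolynomial (Fin N) ℂ)).toLinearMap ∘ₗ
      liftV (lam j))

lemma lift_tprod (v : ∀ j, V (lam j)) :
    lift lam (PiTensorProduct.tprod ℂ v)
      = ∏ j, Polynomial.aeval (MvPolynomial.X j : MvPolynomial (Fin N) ℂ) (liftV (lam j) (v j)) := by
  simp [lift]

lemma lift_tprod_update (v : ∀ j, V (lam j)) (i : Fin N) (w : V (lam i)) :
    lift lam (PiTensorProduct.tprod ℂ (Function.update v i w))
      = Polynomial.aeval (MvPolynomial.X i : MvPolynomial (Fin N) ℂ) (liftV (lam i) w)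
        * ∏ j ∈ Finset.univ.erase i,
          Polynomial.aeval (MvPolynomial.X j : MvPolynomial (Fin N) ℂ) (liftV (lam j) (v j)) := by
  rw [lift_tprod, ← Finset.mul_prod_erase _ _ (Finset.mem_univ i), Function.update_self]
  congr 1
  refine Finset.prod_congr rfl fun j hj => ?_
  rw [Function.update_of_ne (Finset.ne_of_mem_erase hj)]

lemma pderiv_aeval_X (i j : Fin N) (q : ℂ[X]) :
    MvPolynomial.pderiv i (Polynomial.aeval (MvPolynomial.X j : MvPolynomial (Fin N) ℂ) q)
      = if j = i then Polynomial.aeval (MvPolynomial.X j) (derivative q) else 0 := by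
  induction q using Polynomial.induction_on' with
  | add p q hp hq =>
    rw [map_add, map_add, hp, hq]
    split_ifs <;> simp
  | monomial n a =>
    rw [Polynomial.aeval_monomial, Derivation.leibniz, Derivation.leibniz_pow,
      MvPolynomial.pderiv_X]
    split_ifs with h
    · subst h
      simp [derivative_monomial, Polynomial.aeval_monomial, MvPolynomial.algebraMap_eq]
      ring
    · simp [h, MvPolynomial.algebraMap_eq]

lemma pderiv_aeval_mul_prod (i : Fin N) (q : ℂ[X]) (p : Fin N → ℂ[X]) :
    MvPolynomial.pderiv i (Polynomial.aeval (MvPolynomial.X i : MvPolynomial (Fin N) ℂ) q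
        * ∏ j ∈ Finset.univ.erase i, Polynomial.aeval (MvPolynomial.X j) (p j))
      = Polynomial.aeval (MvPolynomial.X i : MvPolynomial (Fin N) ℂ) (derivative q)
        * ∏ j ∈ Finset.univ.erase i, Polynomial.aeval (MvPolynomial.X j) (p j) := by
  have h0 : ∀ s : Finset (Fin N), i ∉ s → MvPolynomial.pderiv i
      (∏ j ∈ s, Polynomial.aeval (MvPolynomial.X j : MvPolynomial (Fin N) ℂ) (p j)) = 0 := by
    intro s
    induction s using Finset.induction_on with
    | empty => simp
    | insert a s ha ih =>
      intro hi
      rw [Finset.mem_insert, not_or] at hi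
      rw [Finset.prod_insert ha, Derivation.leibniz, ih hi.2, pderiv_aeval_X, if_neg (Ne.symm hi.1)]
      simp
  rw [Derivation.leibniz, h0 _ (by simp), pderiv_aeval_X, if_pos rfl]
  simp [mul_comm]

lemma lift_site_fOp (i : Fin N) (ψ : States lam) :
    lift lam (site lam i (fOp (lam i)) ψ)
      = MvPolynomial.C (lam i : ℂ) * MvPolynomial.pderiv i (lift lam ψ)
        - MvPolynomial.X i * MvPolynomial.pderiv i (MvPolynomial.pderiv i (lift lam ψ)) := by
  induction ψ using PiTensorProduct.induction_on with
  | smul_tprod r v =>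
    rw [map_smul, map_smul, map_smul, site_tprod, lift_tprod_update]
    conv_rhs => rw [← Function.update_eq_self i v, lift_tprod_update]
    rw [Derivation.map_smul, Derivation.map_smul, pderiv_aeval_mul_prod, pderiv_aeval_mul_prod, liftV_fOp]
    simp only [MvPolynomial.smul_eq_C_mul, map_sub, map_mul, Polynomial.aeval_C,
      Polynomial.aeval_X, MvPolynomial.algebraMap_eq]
    ring
  | add x y hx hy =>
    simp only [map_add, hx, hy]
    ring

lemma lift_site_hOp (i : Fin N) (ψ : States lam) :
    lift lam (site lam i (hOp (lam i)) ψ)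
      = 2 * (MvPolynomial.X i * MvPolynomial.pderiv i (lift lam ψ))
        - MvPolynomial.C (lam i : ℂ) * lift lam ψ := by
  induction ψ using PiTensorProduct.induction_on with
  | smul_tprod r v =>
    rw [map_smul, map_smul, map_smul, site_tprod, lift_tprod_update]
    conv_rhs => rw [← Function.update_eq_self i v, lift_tprod_update]
    rw [Derivation.map_smul, pderiv_aeval_mul_prod, liftV_hOp]
    simp only [MvPolynomial.smul_eq_C_mul, map_sub, map_mul, Polynomial.aeval_C,
      Polynomial.aeval_X, MvPolynomial.algebraMap_eq, map_ofNat]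
    ring
  | add x y hx hy =>
    simp only [map_add, hx, hy]
    ring

/-- The polynomials whose monomials all have degree larger than `λⱼ` in some `Xⱼ`. -/
def highPart : Submodule ℂ (MvPolynomial (Fin N) ℂ) where
  carrier := {Φ | ∀ k : Fin N →₀ ℕ, (∀ j, k j ≤ lam j) → Φ.coeff k = 0}
  add_mem' ha hb k hk := by simp [ha k hk, hb k hk]
  zero_mem' k _ := by simp
  smul_mem' c Φ h k hk := by simp [h k hk]

lemma coeff_X_pow_mul_eq_zero (i : Fin N) (n : ℕ) (Φ : MvPolynomial (Fin N) ℂ) (k : Fin N →₀ ℕ)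
    (hk : k i < n) : (MvPolynomial.X i ^ n * Φ).coeff k = 0 := by
  rw [MvPolynomial.X_pow_eq_monomial, MvPolynomial.coeff_monomial_mul', if_neg]
  intro h
  have := h i
  simp at this
  omega

lemma lift_site_eOp (i : Fin N) (ψ : States lam) :
    MvPolynomial.X i * lift lam ψ - lift lam (site lam i (eOp (lam i)) ψ) ∈ highPart lam := by
  induction ψ using PiTensorProduct.induction_on with
  | smul_tprod r v =>
    rw [map_smul, map_smul, map_smul, mul_smul_comm, ← smul_sub]
    refine Submodule.smul_mem _ _ ?_
    rw [site_tprod, lift_tprod_update]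
    nth_rewrite 1 [← Function.update_eq_self i v]
    rw [lift_tprod_update, ← mul_assoc, ← sub_mul]
    have h := congrArg (Polynomial.aeval (MvPolynomial.X i : MvPolynomial (Fin N) ℂ))
      (liftV_eOp (lam i) (v i))
    simp only [map_sub, map_mul, Polynomial.aeval_X, map_pow] at h
    rw [h, mul_comm (Polynomial.aeval _ _), mul_assoc]
    exact fun k hk => coeff_X_pow_mul_eq_zero i _ _ k (Nat.lt_succ_of_le (hk i))
  | add x y hx hy =>
    have := Submodule.add_mem _ hx hy
    simp only [map_add, mul_add]
    convert this using 1
    ring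

end Lift

/-! ### Injectivity of the polynomial representation, and components along a lowest weight vector -/

section Nonvanishing

variable {N : ℕ} (lam : Fin N → ℕ)

lemma coeff_prod_aeval_X (q : Fin N → ℂ[X]) (k : Fin N →₀ ℕ) :
    (∏ j, Polynomial.aeval (MvPolynomial.X j : MvPolynomial (Fin N) ℂ) (q j)).coeff k
      = ∏ j, (q j).coeff (k j) := by
  have h1 : ∀ j, Polynomial.aeval (MvPolynomial.X j : MvPolynomial (Fin N) ℂ) (q j)
      = ∑ n ∈ Finset.range ((q j).natDegree + 1),
        MvPolynomial.monomial (Finsupp.single j n) ((q j).coeff n) := by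
    intro j
    rw [Polynomial.aeval_eq_sum_range]
    refine Finset.sum_congr rfl fun n _ => ?_
    rw [MvPolynomial.X_pow_eq_monomial, MvPolynomial.smul_monomial, smul_eq_mul, mul_one]
  have h2 : ∀ n : Fin N → ℕ, ∏ j, MvPolynomial.monomial (Finsupp.single j (n j)) ((q j).coeff (n j))
      = MvPolynomial.monomial (Finsupp.equivFunOnFinite.symm n) (∏ j, (q j).coeff (n j)) := by
    intro n
    rw [← Finsupp.univ_sum_single (Finsupp.equivFunOnFinite.symm n)]
    simp only [Finsupp.equivFunOnFinite_symm_apply_apply]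
    induction (Finset.univ : Finset (Fin N)) using Finset.induction_on with
    | empty => simp
    | insert a s ha ih =>
      rw [Finset.prod_insert ha, ih, Finset.sum_insert ha, Finset.prod_insert ha,
        MvPolynomial.monomial_mul]
  simp only [h1]
  rw [Finset.prod_univ_sum, MvPolynomial.coeff_sum]
  simp only [h2, MvPolynomial.coeff_monomial]
  rw [Finset.sum_eq_single (k : Fin N → ℕ)]
  · rw [if_pos]
    ext j
    simp
  · intro n _ hn
    rw [if_neg]
    rintro rfl
    exact hn (by ext j; simp)
  · intro h
    rw [if_pos (by ext j; simp)]
    simp only [Fintype.mem_piFinset, Finset.mem_range, not_forall] at h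
    obtain ⟨j, hj⟩ := h
    exact Finset.prod_eq_zero (Finset.mem_univ j)
      (coeff_eq_zero_of_natDegree_lt (by omega))

lemma coeff_lift_tprod (v : ∀ j, V (lam j)) (k : Fin N →₀ ℕ) :
    (lift lam (PiTensorProduct.tprod ℂ v)).coeff k
      = ∏ j, ((v j : ℂ[X]).coeff (k j) / ((lam j).descFactorial (k j) : ℂ)) := by
  simp only [lift_tprod, coeff_prod_aeval_X, coeff_liftV]

lemma coeff_lift_eq_zero (ψ : States lam) (k : Fin N →₀ ℕ) (j : Fin N) (hj : lam j < k j) :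
    (lift lam ψ).coeff k = 0 := by
  induction ψ using PiTensorProduct.induction_on with
  | smul_tprod r v =>
    rw [map_smul, MvPolynomial.coeff_smul, coeff_lift_tprod,
      Finset.prod_eq_zero (Finset.mem_univ j), smul_zero]
    rw [coeff_V_eq_zero _ hj, zero_div]
  | add x y hx hy => rw [map_add, MvPolynomial.coeff_add, hx, hy, add_zero]

/-- Up to non-zero descending factorials, the coefficients of the lift in the range `kⱼ ≤ λⱼ` are
the coordinates in the tensor basis of monomials. -/
lemma eq_zero_of_lift_eq_zero {ψ : States lam} (h : lift lam ψ = 0) : ψ = 0 := by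
  let b := Basis.piTensorProduct fun j => degreeLT.basis ℂ (lam j + 1)
  have key : ∀ (p : ∀ j, Fin (lam j + 1)) (ψ : States lam),
      (lift lam ψ).coeff (Finsupp.equivFunOnFinite.symm fun j => (p j : ℕ))
        = b.repr ψ p * ∏ j, ((lam j).descFactorial (p j) : ℂ)⁻¹ := by
    intro p ψ
    induction ψ using PiTensorProduct.induction_on with
    | smul_tprod r v =>
      rw [map_smul, MvPolynomial.coeff_smul, coeff_lift_tprod, map_smul, Finsupp.smul_apply,
        Basis.piTensorProduct_repr_tprod_apply]
      simp only [div_eq_mul_inv, Finset.prod_mul_distrib, smul_eq_mul, mul_assoc]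
      congr 1
    | add x y hx hy =>
      rw [map_add, MvPolynomial.coeff_add, hx, hy, map_add, Finsupp.add_apply, add_mul]
  apply b.repr.map_eq_zero_iff.mp
  ext p
  have := key p ψ
  rw [h, MvPolynomial.coeff_zero, zero_eq_mul, Finset.prod_eq_zero_iff] at this
  rcases this with h | ⟨j, _, hj⟩
  · simpa using h
  · exact absurd hj (inv_ne_zero (descFactorial_ne_zero (by omega)))

lemma coeff_lift_lowering (ψ : States lam) (k : Fin N →₀ ℕ) :
    (lift lam (lowering lam ψ)).coeff k
      = ∑ j, ((k j : ℂ) + 1) * ((lam j : ℂ) - k j) * (lift lam ψ).coeff (k + Finsupp.single j 1) := by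
  rw [lowering, LinearMap.sum_apply, map_sum, MvPolynomial.coeff_sum]
  refine Finset.sum_congr rfl fun j _ => ?_
  rw [lift_site_fOp, MvPolynomial.coeff_sub, MvPolynomial.coeff_C_mul, MvPolynomial.coeff_X_mul',
    MvPolynomial.coeff_pderiv]
  split_ifs with h
  · rw [Finsupp.mem_support_iff] at h
    have hk : k - Finsupp.single j 1 + Finsupp.single j 1 = k :=
      tsub_add_cancel_of_le (by simpa [Nat.one_le_iff_ne_zero] using h)
    rw [MvPolynomial.coeff_pderiv, hk, MvPolynomial.coeff_pderiv]
    simp only [Finsupp.coe_tsub, Pi.sub_apply, Finsupp.single_eq_same]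
    rw [Nat.cast_sub (Nat.one_le_iff_ne_zero.mpr h)]
    push_cast
    ring
  · rw [Finsupp.notMem_support_iff] at h
    rw [h]
    push_cast
    ring

/-- A non-zero subspace of states stable under `∑ⱼ f⁽ʲ⁾` contains a state with a non-zero component along
the lowest weight vector at the `i`-th site. -/
lemma exists_coeff_lift_ne_zero (E : Submodule ℂ (States lam)) (hE : E ≠ ⊥)
    (hinv : ∀ ψ ∈ E, lowering lam ψ ∈ E) (i : Fin N) :
    ∃ ψ ∈ E, ∃ k : Fin N →₀ ℕ, k i = 0 ∧ (lift lam ψ).coeff k ≠ 0 := by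
  -- If no state of `E` has a component with `k i = 0`, then the same follows for `k i = n` by
  -- induction: the coefficient of the lowered state at `k i = n` vanishes, and all its summands
  -- except the one that raises `k i` vanish too.
  by_contra! hcon
  have key : ∀ n : ℕ, ∀ ψ ∈ E, ∀ k : Fin N →₀ ℕ, k i = n → (lift lam ψ).coeff k = 0 := by
    intro n
    induction n with
    | zero => exact hcon
    | succ n ih =>
      intro ψ hψ k hk
      rcases lt_or_ge (lam i) (n + 1) with hn | hn
      · exact coeff_lift_eq_zero lam ψ k i (hk ▸ hn)
      · set k' := k - Finsupp.single i 1 with hk'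
        have hkk : k' + Finsupp.single i 1 = k :=
          tsub_add_cancel_of_le (by simp [hk])
        have hki : k' i = n := by simp [hk', hk]
        have h := coeff_lift_lowering lam ψ k'
        rw [ih _ (hinv ψ hψ) k' hki, Finset.sum_eq_single i, hkk, hki, zero_eq_mul] at h
        · rcases h with h | h
          -- The factor `(n + 1) (λᵢ - n)` cannot vanish because `n + 1 ≤ λᵢ`.
          · rw [mul_eq_zero] at h
            rcases h with h | h
            · exact absurd h (by exact_mod_cast n.succ_ne_zero)
            · rw [sub_eq_zero] at h
              have : lam i = n := by exact_mod_cast h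
              omega
          · exact h
        · intro j _ hj
          rw [ih ψ hψ _ (by simp [hki, Ne.symm hj]), mul_zero]
        · simp
  obtain ⟨ψ, hψ, h0⟩ := Submodule.exists_mem_ne_zero_of_ne_bot hE
  refine h0 (eq_zero_of_lift_eq_zero lam ?_)
  ext k
  simpa using key (k i) ψ hψ k rfl

end Nonvanishing

/-! ### The Hamiltonians as differential operators -/

section PairOperator

variable {N : ℕ} (lam : Fin N → ℕ)

/-- The differential operator
`(λⱼ Xₖ - λₖ Xⱼ) (∂ⱼ - ∂ₖ) - Xⱼ Xₖ (∂ⱼ - ∂ₖ)²`. -/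
def pairOp (j k : Fin N) (Φ : MvPolynomial (Fin N) ℂ) : MvPolynomial (Fin N) ℂ :=
  (MvPolynomial.C (lam j : ℂ) * MvPolynomial.X k - MvPolynomial.C (lam k : ℂ) * MvPolynomial.X j)
      * (MvPolynomial.pderiv j Φ - MvPolynomial.pderiv k Φ)
    - MvPolynomial.X j * MvPolynomial.X k
      * (MvPolynomial.pderiv j (MvPolynomial.pderiv j Φ)
        - 2 * MvPolynomial.pderiv j (MvPolynomial.pderiv k Φ)
        + MvPolynomial.pderiv k (MvPolynomial.pderiv k Φ))

/-- The lifts of `f` and `h` are exact, so the only errors come from replacing each `e` by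
multiplication by its variable. The scalar `λⱼ λₖ / 2` is what `½ h h` gives on the product of
lowest weight vectors. -/
lemma pairOp_sub_lift_casimirPair_mem {j k : Fin N} (hjk : j ≠ k) (ψ : States lam) :
    pairOp lam j k (lift lam ψ) + ((lam j : ℂ) * lam k / 2) • lift lam ψ
      - lift lam (casimirPair lam j k ψ) ∈ highPart lam := by
  have h1 := lift_site_eOp lam j (site lam k (fOp (lam k)) ψ)
  have h2 := lift_site_eOp lam k (site lam j (fOp (lam j)) ψ)
  have h3 := lift_site_hOp lam j (site lam k (hOp (lam k)) ψ)
  have hc : casimirPair lam j k ψ = site lam j (eOp (lam j)) (site lam k (fOp (lam k)) ψ)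
      + site lam k (eOp (lam k)) (site lam j (fOp (lam j)) ψ)
      + (1 / 2 : ℂ) • site lam j (hOp (lam j)) (site lam k (hOp (lam k)) ψ) := by
    rw [casimirPair, site_comm lam hjk (fOp (lam j))]
    rfl
  have hd : MvPolynomial.pderiv j (MvPolynomial.X k : MvPolynomial (Fin N) ℂ) = 0 :=
    MvPolynomial.pderiv_X_of_ne hjk.symm
  convert Submodule.add_mem _ h1 h2 using 1
  rw [hc, map_add, map_add, map_smul, h3, lift_site_hOp, lift_site_fOp, lift_site_fOp, pairOp]
  generalize lift lam (site lam j (eOp (lam j)) _) = a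
  generalize lift lam (site lam k (eOp (lam k)) _) = b
  generalize lift lam ψ = Φ
  have h2d : MvPolynomial.pderiv j (2 : MvPolynomial (Fin N) ℂ) = 0 := by
    simpa using (MvPolynomial.pderiv j).map_natCast 2
  simp only [Derivation.map_sub, Derivation.leibniz, hd, h2d, MvPolynomial.pderiv_C, smul_eq_mul,
    mul_zero, add_zero]
  rw [MvPolynomial.smul_eq_C_mul, MvPolynomial.smul_eq_C_mul]
  have hhalf : (MvPolynomial.C (1 / 2 : ℂ) : MvPolynomial (Fin N) ℂ) * 2 = 1 := by
    rw [← map_ofNat MvPolynomial.C 2, ← map_mul]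
    norm_num
  have hll : (MvPolynomial.C ((lam j : ℂ) * lam k / 2) : MvPolynomial (Fin N) ℂ)
      = MvPolynomial.C (1 / 2) * (MvPolynomial.C (lam j : ℂ) * MvPolynomial.C (lam k : ℂ)) := by
    rw [← map_mul, ← map_mul]
    congr 1
    ring
  rw [hll]
  linear_combination (-2 * MvPolynomial.X j * MvPolynomial.X k
      * MvPolynomial.pderiv j (MvPolynomial.pderiv k Φ)
    + MvPolynomial.C (lam k : ℂ) * MvPolynomial.X j * MvPolynomial.pderiv j Φ
    + MvPolynomial.C (lam j : ℂ) * MvPolynomial.X k * MvPolynomial.pderiv k Φ) * hhalf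

end PairOperator

/-! ### The differential equation with cleared denominators -/

section Equation

variable {N : ℕ} (z : Fin N → ℂ) (lam : Fin N → ℕ) (μ : Fin N → ℂ)

/-- `∏ⱼ (X - zⱼ)`. -/
def nodal : ℂ[X] := ∏ j, (X - C (z j))

/-- `∏_{l ≠ j} (X - z_l)`. -/
def nodalErase (j : Fin N) : ℂ[X] := ∏ l ∈ Finset.univ.erase j, (X - C (z l))

lemma nodal_eq (j : Fin N) : nodal z = (X - C (z j)) * nodalErase z j :=
  (Finset.mul_prod_erase _ _ (Finset.mem_univ j)).symm

/-- The polynomial `D · ∑ⱼ λⱼ / (X - zⱼ)`, where `D = ∏ⱼ (X - zⱼ)`. -/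
def firstCoeff : ℂ[X] := ∑ j, C (lam j : ℂ) * nodalErase z j

/-- The eigenvalue of the `j`-th Hamiltonian on the lowest weight vector. -/
def vacuumEigenvalue (j : Fin N) : ℂ :=
  ∑ k ∈ Finset.univ.erase j, (z j - z k)⁻¹ * ((lam j : ℂ) * lam k / 2)

/-- The polynomial `D · ∑ⱼ (μⱼ - νⱼ) / (X - zⱼ)`, where `D = ∏ⱼ (X - zⱼ)` and `νⱼ` are the
eigenvalues of the Hamiltonians on the lowest weight vector. -/
def zerothCoeff : ℂ[X] := ∑ j, C (μ j - vacuumEigenvalue z lam j) * nodalErase z j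

end Equation

/-! ### Separation of variables -/

section Separation

variable {N : ℕ} (z : Fin N → ℂ) (lam : Fin N → ℕ)

/-- The substitution `Xⱼ ↦ (X - zⱼ) ρⱼ`. -/
def separation (ρ : Fin N → MvPolynomial (Fin N) ℂ) :
    MvPolynomial (Fin N) ℂ →ₐ[ℂ] (MvPolynomial (Fin N) ℂ)[X] :=
  MvPolynomial.aeval fun j => (X - C (MvPolynomial.C (z j))) * C (ρ j)

lemma derivative_separation (ρ : Fin N → MvPolynomial (Fin N) ℂ) (Φ : MvPolynomial (Fin N) ℂ) :
    derivative (separation z ρ Φ) = ∑ j, C (ρ j) * separation z ρ (MvPolynomial.pderiv j Φ) := by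
  induction Φ using MvPolynomial.induction_on with
  | C a =>
    rw [separation, MvPolynomial.aeval_C, Polynomial.algebraMap_apply]
    simp
  | add p q hp hq =>
    simp only [map_add, hp, hq, mul_add, Finset.sum_add_distrib]
  | mul_X p i hp =>
    have hX : separation z ρ (MvPolynomial.X i)
        = (X - C (MvPolynomial.C (z i))) * C (ρ i) := MvPolynomial.aeval_X _ _
    have hj : ∀ j, C (ρ j) * separation z ρ (MvPolynomial.pderiv j (p * MvPolynomial.X i))
        = separation z ρ (MvPolynomial.X i) * (C (ρ j) * separation z ρ (MvPolynomial.pderiv j p))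
          + if j = i then C (ρ i) * separation z ρ p else 0 := by
      intro j
      rw [Derivation.leibniz, MvPolynomial.pderiv_X, smul_eq_mul, smul_eq_mul, map_add, map_mul,
        map_mul]
      rcases eq_or_ne j i with rfl | h
      · simp
        ring
      · simp [h, h.symm]
        ring
    rw [Finset.sum_congr rfl fun j _ => hj j, Finset.sum_add_distrib, ← Finset.mul_sum, ← hp,
      map_mul, derivative_mul, hX]
    simp
    ring

lemma pairOp_symm (j k : Fin N) (Φ : MvPolynomial (Fin N) ℂ) :
    pairOp lam j k Φ = pairOp lam k j Φ := by
  have : MvPolynomial.pderiv j (MvPolynomial.pderiv k Φ)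
      = MvPolynomial.pderiv k (MvPolynomial.pderiv j Φ) := by
    have h : ⁅(MvPolynomial.pderiv j : Derivation ℂ (MvPolynomial (Fin N) ℂ) _),
        MvPolynomial.pderiv k⁆ = (0 : Derivation ℂ (MvPolynomial (Fin N) ℂ) (MvPolynomial (Fin N) ℂ)) := by
      refine MvPolynomial.derivation_ext fun i => ?_
      rw [Derivation.commutator_apply, MvPolynomial.pderiv_X, MvPolynomial.pderiv_X]
      simp only [Pi.single_apply]
      split_ifs <;> simp
    have := congrArg (fun d => d Φ) h
    simpa [Derivation.commutator_apply, sub_eq_zero] using this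
  rw [pairOp, pairOp, this]
  ring

lemma nodalErase_sub {j k : Fin N} (hjk : j ≠ k) :
    nodalErase z j - nodalErase z k
      = C (z j - z k) * ∏ l ∈ (Finset.univ.erase j).erase k, (X - C (z l)) := by
  have h1 : nodalErase z j
      = (X - C (z k)) * ∏ l ∈ (Finset.univ.erase j).erase k, (X - C (z l)) :=
    (Finset.mul_prod_erase _ _ (by simp [hjk.symm])).symm
  have h2 : nodalErase z k
      = (X - C (z j)) * ∏ l ∈ (Finset.univ.erase j).erase k, (X - C (z l)) := by
    rw [Finset.erase_right_comm]
    exact (Finset.mul_prod_erase _ _ (by simp [hjk])).symm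
  rw [h1, h2, C_sub]
  ring

/-- The quantum separation of variables: under the substitution `Xⱼ ↦ (X - zⱼ) ρⱼ` with
`∑ⱼ ρⱼ = 0` the Gaudin Hamiltonians become an ordinary differential operator. -/
lemma separation_identity (hz : Function.Injective z) (ρ : Fin N → MvPolynomial (Fin N) ℂ)
    (hρ : ∑ j, ρ j = 0) (Φ : MvPolynomial (Fin N) ℂ) :
    (nodal z).map MvPolynomial.C * derivative (derivative (separation z ρ Φ))
      - (firstCoeff z lam).map MvPolynomial.C * derivative (separation z ρ Φ)
      = ∑ j, (nodalErase z j).map MvPolynomial.C *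
          separation z ρ (∑ k ∈ Finset.univ.erase j, (z j - z k)⁻¹ • pairOp lam j k Φ) := by
  set D : (MvPolynomial (Fin N) ℂ)[X] := (nodal z).map MvPolynomial.C with hD
  set d : Fin N → (MvPolynomial (Fin N) ℂ)[X] := fun j => (nodalErase z j).map MvPolynomial.C with hd
  set r : Fin N → (MvPolynomial (Fin N) ℂ)[X] := fun j => C (ρ j) with hr
  set u := fun j => separation z ρ (MvPolynomial.pderiv j Φ) with hu
  set w := fun j k => separation z ρ (MvPolynomial.pderiv j (MvPolynomial.pderiv k Φ)) with hw
  set l : Fin N → (MvPolynomial (Fin N) ℂ)[X] := fun j => C (MvPolynomial.C (lam j : ℂ)) with hl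
  have hr0 : ∑ j, r j = 0 := by rw [hr, ← map_sum, hρ, map_zero]
  have hA : (firstCoeff z lam).map MvPolynomial.C = ∑ j, l j * d j := by
    rw [firstCoeff, Polynomial.map_sum]
    simp [hl, hd]
  have h1 : derivative (separation z ρ Φ) = ∑ j, r j * u j := derivative_separation z ρ Φ
  have h2 : derivative (derivative (separation z ρ Φ)) = ∑ j, ∑ k, r j * r k * w k j := by
    rw [h1, derivative_sum]
    refine Finset.sum_congr rfl fun j _ => ?_
    rw [derivative_mul, derivative_C, zero_mul, zero_add, derivative_separation, Finset.mul_sum]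
    simp only [hr, hw, mul_assoc]
  -- The quotient `(d j - d k)/(zⱼ - zₖ)` is the product over the remaining nodes. The factors `X -
  -- zⱼ` and `X - zₖ` produced by the substitution complete it to `d j`, `d k` or `D`, so no
  -- denominators survive.
  have hp : ∀ j k, j ≠ k → (z j - z k)⁻¹ • ((d j - d k) * separation z ρ (pairOp lam j k Φ))
      = (l j * r k * d j - l k * r j * d k) * (u j - u k)
        - D * r j * r k * (w j j - 2 * w j k + w k k) := by
    intro j k hjk
    set djk : (MvPolynomial (Fin N) ℂ)[X] :=
      (∏ l ∈ (Finset.univ.erase j).erase k, (X - C (z l))).map MvPolynomial.C with hdjk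
    have e1 : d j - d k = C (MvPolynomial.C (z j - z k)) * djk := by
      rw [hd, hdjk]
      simp only []
      rw [← Polynomial.map_sub, nodalErase_sub z hjk, Polynomial.map_mul, Polynomial.map_C]
    have e2 : d j = (X - C (MvPolynomial.C (z k))) * djk := by
      rw [hd, hdjk]
      simp only [nodalErase]
      rw [← Finset.mul_prod_erase _ _ (show k ∈ Finset.univ.erase j by simp [hjk.symm]),
        Polynomial.map_mul]
      simp
    have e3 : d k = (X - C (MvPolynomial.C (z j))) * djk := by
      rw [map_sub, map_sub] at e1
      linear_combination e2 - e1
    have e4 : D = (X - C (MvPolynomial.C (z j))) * d j := by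
      rw [hD, nodal_eq z j, Polynomial.map_mul]
      simp [hd]
    have hev : separation z ρ (pairOp lam j k Φ)
        = (l j * ((X - C (MvPolynomial.C (z k))) * r k)
            - l k * ((X - C (MvPolynomial.C (z j))) * r j)) * (u j - u k)
          - ((X - C (MvPolynomial.C (z j))) * r j) * ((X - C (MvPolynomial.C (z k))) * r k)
            * (w j j - 2 * w j k + w k k) := by
      have hX : ∀ i, separation z ρ (MvPolynomial.X i)
        = (X - C (MvPolynomial.C (z i))) * r i := fun i => MvPolynomial.aeval_X _ _
      have hC : ∀ c, separation z ρ (MvPolynomial.C c) = C (MvPolynomial.C c) := by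
        intro c
        rw [separation, MvPolynomial.aeval_C, Polynomial.algebraMap_apply,
          MvPolynomial.algebraMap_eq]
      rw [pairOp]
      simp only [map_sub, map_add, map_mul, hX, hC, map_ofNat]
      rfl
    have hc : (z j - z k)⁻¹ • (d j - d k) = djk := by
      rw [e1, ← smul_mul_assoc, Polynomial.smul_C, MvPolynomial.smul_eq_C_mul, ← map_mul,
        inv_mul_cancel₀ (sub_ne_zero.mpr (hz.ne hjk)), map_one, map_one, one_mul]
    rw [← smul_mul_assoc, hc, hev, e4]
    rw [e3, e2]
    ring
  have hpd : ∀ j, (l j * r j * d j - l j * r j * d j) * (u j - u j)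
        - D * r j * r j * (w j j - 2 * w j j + w j j) = 0 := by
    intro j
    ring
  -- After expansion, each summand in which `r j` or `r k` is the only dependence on its index drops
  -- out because `∑ r = 0`. What is left is twice the second-order and first-order terms of the
  -- ordinary differential operator.
  have hsum : ∑ j, ∑ k, ((l j * r k * d j - l k * r j * d k) * (u j - u k)
        - D * r j * r k * (w j j - 2 * w j k + w k k))
      = 2 * (D * (∑ j, ∑ k, r j * r k * w k j) - (∑ j, l j * d j) * ∑ j, r j * u j) := by
    have e : ∀ j k, (l j * r k * d j - l k * r j * d k) * (u j - u k)
        - D * r j * r k * (w j j - 2 * w j k + w k k)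
        = (l j * d j * u j) * r k - (l j * d j) * (r k * u k) - (r j * u j) * (l k * d k)
          + r j * (l k * d k * u k) - (D * r j * w j j) * r k + (2 * D) * (r k * r j * w j k)
          - r j * (D * r k * w k k) := fun j k => by ring
    have hcomm : ∑ j, ∑ k, r k * r j * w j k = ∑ j, ∑ k, r j * r k * w k j := Finset.sum_comm
    simp only [e, Finset.sum_add_distrib, Finset.sum_sub_distrib]
    simp only [← Finset.mul_sum, ← Finset.sum_mul, hr0, hcomm]
    ring
  -- Symmetrization in `(j, k)`: `pairOp` is symmetric while `(zⱼ - zₖ)⁻¹` is antisymmetric, so `d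
  -- j` is replaced by `d j - d k`.
  have hsymm : (2 : (MvPolynomial (Fin N) ℂ)[X]) * ∑ j, d j *
        separation z ρ (∑ k ∈ Finset.univ.erase j, (z j - z k)⁻¹ • pairOp lam j k Φ)
      = ∑ j, ∑ k, ((l j * r k * d j - l k * r j * d k) * (u j - u k)
        - D * r j * r k * (w j j - 2 * w j k + w k k)) := by
    set t := fun j k => (z j - z k)⁻¹ • (d j * separation z ρ (pairOp lam j k Φ)) with ht
    have ht0 : ∀ j, t j j = 0 := fun j => by simp [ht]
    have s1 : ∑ j, d j *
        separation z ρ (∑ k ∈ Finset.univ.erase j, (z j - z k)⁻¹ • pairOp lam j k Φ)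
        = ∑ j, ∑ k, t j k := by
      refine Finset.sum_congr rfl fun j _ => ?_
      rw [← Finset.sum_erase _ (ht0 j), map_sum, Finset.mul_sum]
      refine Finset.sum_congr rfl fun k _ => ?_
      rw [map_smul, mul_smul_comm]
    rw [s1, two_mul]
    nth_rewrite 2 [Finset.sum_comm]
    rw [← Finset.sum_add_distrib]
    refine Finset.sum_congr rfl fun j _ => ?_
    rw [← Finset.sum_add_distrib]
    refine Finset.sum_congr rfl fun k _ => ?_
    rcases eq_or_ne j k with rfl | hjk
    · rw [ht0, hpd, add_zero]
    · rw [← hp j k hjk]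
      simp only [ht]
      rw [pairOp_symm lam k j, ← neg_sub (z j) (z k), inv_neg, neg_smul, sub_mul, smul_sub,
        ← sub_eq_add_neg]
  have h22 : (2 : (MvPolynomial (Fin N) ℂ)[X]) ≠ 0 := by
    exact two_ne_zero
  apply mul_left_cancel₀ h22
  rw [hsymm, hsum, hA, h1, ← h2, h1]

end Separation

/-! ### Extraction of a coefficient -/

section CoeffMap

variable {N : ℕ}

/-- The coefficient of `r^κ` in a polynomial in `X` whose coefficients are polynomials in the
variables `r`. -/
def coeffMap (κ : Fin N →₀ ℕ) (P : (MvPolynomial (Fin N) ℂ)[X]) : ℂ[X] :=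
  P.sum fun n a => monomial n (a.coeff κ)

lemma coeff_coeffMap (κ : Fin N →₀ ℕ) (P : (MvPolynomial (Fin N) ℂ)[X]) (n : ℕ) :
    (coeffMap κ P).coeff n = (P.coeff n).coeff κ := by
  rw [coeffMap, Polynomial.sum_def, finsetSum_coeff]
  simp only [coeff_monomial]
  rw [Finset.sum_ite_eq']
  split_ifs with h
  · rfl
  · rw [notMem_support_iff.mp h, MvPolynomial.coeff_zero]

lemma coeffMap_sub (κ : Fin N →₀ ℕ) (P Q : (MvPolynomial (Fin N) ℂ)[X]) :
    coeffMap κ (P - Q) = coeffMap κ P - coeffMap κ Q := by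
  ext n
  simp [coeff_coeffMap]

lemma coeffMap_sum {ι : Type*} (κ : Fin N →₀ ℕ) (s : Finset ι)
    (P : ι → (MvPolynomial (Fin N) ℂ)[X]) :
    coeffMap κ (∑ i ∈ s, P i) = ∑ i ∈ s, coeffMap κ (P i) := by
  ext n
  simp [coeff_coeffMap, finsetSum_coeff, MvPolynomial.coeff_sum]

lemma coeffMap_derivative (κ : Fin N →₀ ℕ) (P : (MvPolynomial (Fin N) ℂ)[X]) :
    coeffMap κ (derivative P) = derivative (coeffMap κ P) := by
  ext n
  rw [coeff_coeffMap, coeff_derivative, coeff_derivative, coeff_coeffMap]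
  rw [show ((n : MvPolynomial (Fin N) ℂ) + 1) = MvPolynomial.C ((n : ℂ) + 1) by simp,
    mul_comm, MvPolynomial.coeff_C_mul, mul_comm]

lemma coeffMap_map_mul (κ : Fin N →₀ ℕ) (q : ℂ[X]) (P : (MvPolynomial (Fin N) ℂ)[X]) :
    coeffMap κ (q.map MvPolynomial.C * P) = q * coeffMap κ P := by
  ext n
  rw [coeff_coeffMap, coeff_mul, coeff_mul, MvPolynomial.coeff_sum]
  refine Finset.sum_congr rfl fun x _ => ?_
  rw [coeff_map, MvPolynomial.coeff_C_mul, coeff_coeffMap]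

lemma eval_coeffMap (κ : Fin N →₀ ℕ) (P : (MvPolynomial (Fin N) ℂ)[X]) (c : ℂ) :
    (coeffMap κ P).eval c = (P.eval (MvPolynomial.C c)).coeff κ := by
  induction P using Polynomial.induction_on' with
  | add p q hp hq =>
    have : coeffMap κ (p + q) = coeffMap κ p + coeffMap κ q := by
      ext n
      simp [coeff_coeffMap]
    rw [this, eval_add, eval_add, MvPolynomial.coeff_add, hp, hq]
  | monomial n a =>
    rw [coeffMap, Polynomial.sum_monomial_index _ _ (by simp), eval_monomial, eval_monomial,
      ← map_pow, mul_comm a, MvPolynomial.coeff_C_mul, mul_comm]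

lemma coeff_aeval_C_mul_X (c : Fin N → ℂ) (Φ : MvPolynomial (Fin N) ℂ) (κ : Fin N →₀ ℕ) :
    (MvPolynomial.aeval (fun j => MvPolynomial.C (c j) * MvPolynomial.X j) Φ :
      MvPolynomial (Fin N) ℂ).coeff κ = (∏ j, c j ^ κ j) * Φ.coeff κ := by
  induction Φ using MvPolynomial.induction_on' with
  | add p q hp hq => rw [map_add, MvPolynomial.coeff_add, hp, hq, MvPolynomial.coeff_add, mul_add]
  | monomial k a =>
    rw [MvPolynomial.aeval_monomial, Finsupp.prod_fintype _ _ (by simp)]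
    simp only [mul_pow, Finset.prod_mul_distrib, ← map_pow, ← map_prod]
    have : ∏ j, (MvPolynomial.X j : MvPolynomial (Fin N) ℂ) ^ k j = MvPolynomial.monomial k 1 := by
      rw [MvPolynomial.monomial_eq, Finsupp.prod_fintype _ _ (by simp), map_one, one_mul]
    rw [this, MvPolynomial.algebraMap_eq, MvPolynomial.C_mul_monomial, MvPolynomial.C_mul_monomial,
      MvPolynomial.coeff_monomial, MvPolynomial.coeff_monomial]
    split_ifs with h
    · subst h
      ring
    · simp

end CoeffMap

/-! ### Truncated solutions at the singular points -/

section Truncated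

variable {N : ℕ} (z : Fin N → ℂ) (lam : Fin N → ℕ)

/-- Each monomial of `Θ` contains some `Xⱼ^(λⱼ+1)`. For `j = i` the substitution turns it into a
multiple of `(X - zᵢ)^(λᵢ+1)`; for `j ≠ i` it becomes a multiple of `rⱼ^(λⱼ+1)`, which cannot
contribute to the coefficient of `r^κ`. -/
lemma dvd_coeffMap_separation (i : Fin N) (ρ : Fin N → MvPolynomial (Fin N) ℂ)
    (hρ : ∀ j, j ≠ i → ρ j = MvPolynomial.X j) {Θ : MvPolynomial (Fin N) ℂ}
    (hΘ : Θ ∈ highPart lam) (κ : Fin N →₀ ℕ) (hκ : ∀ j, κ j ≤ lam j) :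
    (X - C (z i)) ^ (lam i + 1) ∣ coeffMap κ (separation z ρ Θ) := by
  rw [Θ.as_sum, map_sum, coeffMap_sum]
  refine Finset.dvd_sum fun k hk => ?_
  obtain ⟨j, hj⟩ : ∃ j, lam j < k j := by
    by_contra! h
    exact (MvPolynomial.mem_support_iff.mp hk) (hΘ k h)
  have hk' : k = Finsupp.single j (lam j + 1) + (k - Finsupp.single j (lam j + 1)) :=
    (add_tsub_cancel_of_le (Finsupp.single_le_iff.mpr hj)).symm
  rw [hk', ← one_mul (MvPolynomial.coeff _ Θ), ← MvPolynomial.monomial_mul, map_mul,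
    ← MvPolynomial.X_pow_eq_monomial, map_pow, separation, MvPolynomial.aeval_X]
  rcases eq_or_ne j i with rfl | hji
  · rw [mul_pow, mul_assoc]
    have : (X - C (MvPolynomial.C (z j)) : (MvPolynomial (Fin N) ℂ)[X]) ^ (lam j + 1)
        = ((X - C (z j)) ^ (lam j + 1)).map MvPolynomial.C := by
      simp
    rw [this, coeffMap_map_mul]
    exact dvd_mul_right _ _
  · rw [mul_pow, mul_comm (_ ^ _) (_ ^ _), mul_assoc, hρ j hji, ← map_pow]
    convert dvd_zero _
    ext n
    rw [coeff_coeffMap, coeff_C_mul, coeff_X_pow_mul_eq_zero _ _ _ _ (Nat.lt_succ_of_le (hκ j)),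
      coeff_zero]

/-- The subspace of common eigenvectors of the Hamiltonians with eigenvalues `μ`. -/
def jointEigenspace (μ : Fin N → ℂ) : Submodule ℂ (States lam) where
  carrier := {ψ | ∀ i, hamiltonian z lam i ψ = μ i • ψ}
  add_mem' ha hb i := by rw [map_add, ha i, hb i, smul_add]
  zero_mem' i := by simp
  smul_mem' c ψ h i := by rw [map_smul, h i, smul_comm]

lemma hamiltonian_eq (i : Fin N) :
    hamiltonian z lam i = ∑ j ∈ Finset.univ.erase i, (z i - z j)⁻¹ • casimirPair lam i j := rfl

lemma sum_pairOp_sub_mem {μ : Fin N → ℂ} {ψ : States lam} (hψ : ψ ∈ jointEigenspace z lam μ)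
    (j : Fin N) :
    ∑ k ∈ Finset.univ.erase j, (z j - z k)⁻¹ • pairOp lam j k (lift lam ψ)
      - (μ j - vacuumEigenvalue z lam j) • lift lam ψ ∈ highPart lam := by
  have h : ∑ k ∈ Finset.univ.erase j, (z j - z k)⁻¹ •
      (pairOp lam j k (lift lam ψ) + ((lam j : ℂ) * lam k / 2) • lift lam ψ
        - lift lam (casimirPair lam j k ψ)) ∈ highPart lam :=
    Submodule.sum_mem _ fun k hk => Submodule.smul_mem _ _
      (pairOp_sub_lift_casimirPair_mem lam (Finset.ne_of_mem_erase hk).symm ψ)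
  convert h using 1
  have h1 : ∑ k ∈ Finset.univ.erase j, (z j - z k)⁻¹ • lift lam (casimirPair lam j k ψ)
      = μ j • lift lam ψ := by
    rw [← map_smul, ← hψ j, hamiltonian_eq, LinearMap.sum_apply, map_sum]
    simp
  simp only [smul_sub, smul_add, Finset.sum_sub_distrib, Finset.sum_add_distrib, h1, smul_smul]
  rw [← Finset.sum_smul, sub_smul, vacuumEigenvalue]
  ring

/-- An eigenvector of the Gaudin Hamiltonians yields a polynomial, not vanishing at `zᵢ`, that
solves the differential equation up to order `λᵢ + 1` at `zᵢ`. -/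
theorem exists_truncated_solution (hz : Function.Injective z) (μ : Fin N → ℂ)
    (hΨ : ∃ Ψ : States lam, Ψ ≠ 0 ∧ ∀ i, hamiltonian z lam i Ψ = μ i • Ψ) (i : Fin N) :
    ∃ p : ℂ[X], p.eval (z i) ≠ 0 ∧ (X - C (z i)) ^ (lam i + 1) ∣
      nodal z * derivative (derivative p) - firstCoeff z lam * derivative p
        - zerothCoeff z lam μ * p := by
  obtain ⟨Ψ, hΨ0, hΨ⟩ := hΨ
  -- The given `Ψ` may have no component along the lowest weight vector at site `i`; another vector
  -- of the same joint eigenspace, with the same eigenvalues, replaces it.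
  obtain ⟨ψ, hψ, κ, hκi, hκ0⟩ := exists_coeff_lift_ne_zero lam (jointEigenspace z lam μ)
    (Submodule.ne_bot_iff _ |>.mpr ⟨Ψ, hΨ, hΨ0⟩)
    (fun ψ hψ j => by
      have h := congrArg (fun T => T ψ) (commute_lowering_hamiltonian lam z j).eq
      simp only [Module.End.mul_apply] at h
      rw [← h, hψ j, map_smul]) i
  have hκ : ∀ j, κ j ≤ lam j := by
    intro j
    by_contra! h
    exact hκ0 (coeff_lift_eq_zero lam ψ κ j h)
  -- All `ρⱼ` with `j ≠ i` are independent variables, and `ρᵢ` is then forced by `∑ ρⱼ = 0`.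
  set ρ : Fin N → MvPolynomial (Fin N) ℂ := fun j =>
    if j = i then -∑ l ∈ Finset.univ.erase i, MvPolynomial.X l else MvPolynomial.X j with hρ
  have hρi : ∀ j, j ≠ i → ρ j = MvPolynomial.X j := fun j hj => if_neg hj
  have hρ0 : ∑ j, ρ j = 0 := by
    rw [← Finset.add_sum_erase _ _ (Finset.mem_univ i), hρ]
    simp only [if_true]
    rw [Finset.sum_congr rfl fun j hj => if_neg (Finset.ne_of_mem_erase hj)]
    simp
  set Φ := lift lam ψ with hΦ
  refine ⟨coeffMap κ (separation z ρ Φ), ?_, ?_⟩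
  · rw [eval_coeffMap]
    -- At `X = zᵢ` the dependent `ρᵢ` is multiplied by zero and disappears, so each remaining
    -- variable is merely rescaled.
    have : (separation z ρ Φ).eval (MvPolynomial.C (z i))
        = MvPolynomial.aeval (fun j => MvPolynomial.C (z i - z j) * MvPolynomial.X j) Φ := by
      have h : ((Polynomial.aeval (MvPolynomial.C (z i) : MvPolynomial (Fin N) ℂ)).restrictScalars
          ℂ).comp (separation z ρ)
          = MvPolynomial.aeval (fun j => MvPolynomial.C (z i - z j) * MvPolynomial.X j) := by
        refine MvPolynomial.algHom_ext fun j => ?_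
        rcases eq_or_ne j i with rfl | hj
        · simp [separation]
        · simp [separation, hρi j hj]
      rw [← h]
      simp [Polynomial.coe_aeval_eq_eval]
    rw [this, coeff_aeval_C_mul_X]
    refine mul_ne_zero (Finset.prod_ne_zero_iff.mpr fun j _ => ?_) hκ0
    -- The factor at `j = i` is `0 ^ 0 = 1`, which is where `κ i = 0` is needed.
    rcases eq_or_ne j i with rfl | hj
    · simp [hκi]
    · exact pow_ne_zero _ (sub_ne_zero.mpr (hz.ne hj.symm))
  · have key : (nodal z).map MvPolynomial.C * derivative (derivative (separation z ρ Φ))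
        - (firstCoeff z lam).map MvPolynomial.C * derivative (separation z ρ Φ)
        - (zerothCoeff z lam μ).map MvPolynomial.C * separation z ρ Φ
        = ∑ j, (nodalErase z j).map MvPolynomial.C * separation z ρ
          (∑ k ∈ Finset.univ.erase j, (z j - z k)⁻¹ • pairOp lam j k Φ
            - (μ j - vacuumEigenvalue z lam j) • Φ) := by
      rw [separation_identity z lam hz ρ hρ0, zerothCoeff, Polynomial.map_sum, Finset.sum_mul,
        ← Finset.sum_sub_distrib]
      refine Finset.sum_congr rfl fun j _ => ?_
      rw [map_sub (separation z ρ), map_smul, mul_sub, Polynomial.map_mul, Polynomial.map_C,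
        Algebra.smul_def, Polynomial.algebraMap_apply, MvPolynomial.algebraMap_eq]
      ring
    have h := congrArg (coeffMap κ) key
    rw [coeffMap_sub, coeffMap_sub, coeffMap_map_mul, coeffMap_map_mul, coeffMap_map_mul,
      coeffMap_derivative, coeffMap_derivative, coeffMap_sum] at h
    rw [h]
    refine Finset.dvd_sum fun j _ => ?_
    rw [coeffMap_map_mul]
    exact (dvd_coeffMap_separation z lam i ρ hρi (sum_pairOp_sub_mem z lam hψ j) κ hκ).mul_left _

end Truncated

/-! ### Convergent power series -/

section PowerSeriesAt

/-- The power series `s` converges near `0` and represents `g` there. -/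
def HasPowerSeries (g : ℂ → ℂ) (s : PowerSeries ℂ) : Prop :=
  ∀ᶠ t in 𝓝 (0 : ℂ), HasSum (fun n => PowerSeries.coeff n s * t ^ n) (g t)

lemma hasPowerSeries_iff {g : ℂ → ℂ} {s : PowerSeries ℂ} :
    HasPowerSeries g s ↔ HasFPowerSeriesAt g
      (FormalMultilinearSeries.ofScalars ℂ fun n => PowerSeries.coeff n s) 0 := by
  rw [hasFPowerSeriesAt_iff]
  simp [HasPowerSeries, mul_comm]

lemma HasPowerSeries.analyticAt {g : ℂ → ℂ} {s : PowerSeries ℂ} (h : HasPowerSeries g s) :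
    AnalyticAt ℂ g 0 := (hasPowerSeries_iff.mp h).analyticAt

lemma HasPowerSeries.sub {f g : ℂ → ℂ} {s t : PowerSeries ℂ} (hf : HasPowerSeries f s)
    (hg : HasPowerSeries g t) : HasPowerSeries (fun x => f x - g x) (s - t) := by
  filter_upwards [hf, hg] with x h1 h2
  simpa [sub_mul] using h1.sub h2

lemma HasPowerSeries.add {f g : ℂ → ℂ} {s t : PowerSeries ℂ} (hf : HasPowerSeries f s)
    (hg : HasPowerSeries g t) : HasPowerSeries (fun x => f x + g x) (s + t) := by
  filter_upwards [hf, hg] with x h1 h2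
  simpa [add_mul] using h1.add h2

lemma HasPowerSeries.const_mul {f : ℂ → ℂ} {s : PowerSeries ℂ} (hf : HasPowerSeries f s) (a : ℂ) :
    HasPowerSeries (fun x => a * f x) (PowerSeries.C a * s) := by
  filter_upwards [hf] with x h1
  simpa [mul_assoc] using h1.mul_left a

lemma HasPowerSeries.X_mul {f : ℂ → ℂ} {s : PowerSeries ℂ} (hf : HasPowerSeries f s) :
    HasPowerSeries (fun x => x * f x) (PowerSeries.X * s) := by
  filter_upwards [hf] with x h1
  rw [← hasSum_nat_add_iff' 1]
  simp only [PowerSeries.coeff_succ_X_mul, Finset.range_one, Finset.sum_singleton,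
    PowerSeries.coeff_zero_X_mul, zero_mul, sub_zero]
  have e : (fun n => PowerSeries.coeff n s * x ^ (n + 1))
      = fun n => x * (PowerSeries.coeff n s * x ^ n) := by
    funext n
    ring
  rw [e]
  exact h1.mul_left x

lemma HasPowerSeries.poly_mul {f : ℂ → ℂ} {s : PowerSeries ℂ} (hf : HasPowerSeries f s)
    (q : ℂ[X]) : HasPowerSeries (fun x => q.eval x * f x) ((q : PowerSeries ℂ) * s) := by
  induction q using Polynomial.induction_on with
  | C a => simpa using hf.const_mul a
  | add p q hp hq => simpa [add_mul] using hp.add hq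
  | monomial n a h =>
    convert h.X_mul using 1
    · ext x
      simp
      ring
    · simp only [Polynomial.coe_mul, Polynomial.coe_C, Polynomial.coe_pow, Polynomial.coe_X]
      ring

lemma HasPowerSeries.deriv {f : ℂ → ℂ} {s : PowerSeries ℂ} (hf : HasPowerSeries f s) :
    HasPowerSeries (deriv f) (PowerSeries.derivative ℂ s) := by
  obtain ⟨r, hr⟩ := hasPowerSeries_iff.mp hf
  have h := (hasFPowerSeriesAt_iff.mp (⟨r, hr.fderiv⟩ : HasFPowerSeriesAt _ _ _))
  filter_upwards [h] with x hx
  have h2 := hx.mapL (ContinuousLinearMap.apply ℂ ℂ (1 : ℂ))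
  simp only [map_smul, ContinuousLinearMap.apply_apply,
    FormalMultilinearSeries.derivSeries_coeff_one, zero_add, fderiv_apply_one_eq_deriv] at h2
  have e : (fun n => PowerSeries.coeff n (PowerSeries.derivative ℂ s) * x ^ n)
      = fun n => x ^ n • (n + 1) • (FormalMultilinearSeries.ofScalars ℂ
        fun n => PowerSeries.coeff n s).coeff (n + 1) := by
    funext n
    rw [PowerSeries.coeff_derivative]
    simp
    ring
  rw [e]
  exact h2

lemma exists_hasPowerSeries (s : PowerSeries ℂ) (M K : ℝ) (hK : 0 < K)
    (h : ∀ n, ‖PowerSeries.coeff n s‖ ≤ M * K ^ n) : ∃ g, HasPowerSeries g s := by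
  refine ⟨fun t => ∑' n, PowerSeries.coeff n s * t ^ n, ?_⟩
  have : Metric.ball (0 : ℂ) (1 / K) ∈ 𝓝 (0 : ℂ) := Metric.ball_mem_nhds _ (by positivity)
  filter_upwards [this] with t ht
  refine Summable.hasSum ?_
  rw [mem_ball_zero_iff, lt_div_iff₀ hK] at ht
  refine Summable.of_norm_bounded (g := fun n => M * (‖t‖ * K) ^ n)
    ((summable_geometric_of_lt_one (by positivity) ht).mul_left M) fun n => ?_
  rw [norm_mul, norm_pow, mul_pow, mul_comm (‖t‖ ^ n), ← mul_assoc]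
  exact mul_le_mul_of_nonneg_right (h n) (by positivity)

lemma HasPowerSeries.apply_zero {g : ℂ → ℂ} {s : PowerSeries ℂ} (h : HasPowerSeries g s) :
    g 0 = PowerSeries.coeff 0 s := by
  have h0 := h.self_of_nhds
  refine h0.unique ?_
  convert hasSum_single (f := fun n => PowerSeries.coeff n s * (0 : ℂ) ^ n) 0 ?_ using 1
  · simp
  · intro n hn
    simp [hn]

lemma HasPowerSeries.eq_zero_of_eventually {g : ℂ → ℂ} {s : PowerSeries ℂ}
    (h : HasPowerSeries g s) (hg : ∀ᶠ t in 𝓝 0, g t = 0) : s = 0 := by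
  have h0 : HasFPowerSeriesAt (fun _ => 0 : ℂ → ℂ)
      (FormalMultilinearSeries.ofScalars ℂ fun n => PowerSeries.coeff n s) 0 :=
    (hasPowerSeries_iff.mp h).congr hg
  have := h0.eq_zero
  ext n
  have h2 := congrArg (fun p => FormalMultilinearSeries.coeff p n) this
  simp only [FormalMultilinearSeries.coeff_ofScalars] at h2
  rw [h2]
  rfl

end PowerSeriesAt

/-! ### The Frobenius method -/

section Frobenius

/-- A sequence with prescribed first `L` terms, given afterwards by a linear recursion. -/
def frobeniusSeq (L : ℕ) (c₀ : ℕ → ℂ) (w : ℕ → ℕ → ℂ) (n : ℕ) : ℂ :=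
  if n < L then c₀ n else ∑ k : Fin n, w n k * frobeniusSeq L c₀ w k
decreasing_by exact k.2

/-- Beyond `L`, the partial sums of the norms grow by a factor of at most `1 + A` at each step. -/
lemma norm_le_of_recursion (c : ℕ → ℂ) (L : ℕ) (A : ℝ) (hA : 0 ≤ A)
    (h : ∀ n, L ≤ n → ‖c n‖ ≤ A * ∑ k ∈ Finset.range n, ‖c k‖) :
    ∃ M, ∀ n, ‖c n‖ ≤ M * (1 + A) ^ n := by
  set S : ℕ → ℝ := fun n => ∑ k ∈ Finset.range n, ‖c k‖ with hS
  have hS0 : ∀ n, 0 ≤ S n := fun n => Finset.sum_nonneg fun _ _ => norm_nonneg _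
  have hS1 : ∀ n, S (n + 1) = S n + ‖c n‖ := fun n => Finset.sum_range_succ _ _
  have key : ∀ n, S n ≤ S L * (1 + A) ^ n := by
    intro n
    induction n with
    | zero => simpa [hS] using hS0 L
    | succ n ih =>
      rcases lt_or_ge n L with hn | hn
      · calc S (n + 1) ≤ S L := Finset.sum_le_sum_of_subset_of_nonneg
              (Finset.range_mono hn) fun _ _ _ => norm_nonneg _
          _ ≤ S L * (1 + A) ^ (n + 1) :=
            le_mul_of_one_le_right (hS0 L) (one_le_pow₀ (by linarith))
      · calc S (n + 1) ≤ S n + A * S n := by rw [hS1]; linarith [h n hn]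
          _ = (1 + A) * S n := by ring
          _ ≤ (1 + A) * (S L * (1 + A) ^ n) := by gcongr
          _ = _ := by ring
  refine ⟨S L * (1 + A), fun n => ?_⟩
  calc ‖c n‖ ≤ S (n + 1) := by rw [hS1]; linarith [hS0 n]
    _ ≤ S L * (1 + A) ^ (n + 1) := key _
    _ = _ := by ring

lemma coeff_mul_eq_sum_range (q s : PowerSeries ℂ) (m : ℕ) :
    PowerSeries.coeff m (q * s)
      = ∑ k ∈ Finset.range (m + 1), PowerSeries.coeff (m - k) q * PowerSeries.coeff k s := by
  rw [mul_comm, PowerSeries.coeff_mul, Finset.Nat.sum_antidiagonal_eq_sum_range_succ_mk]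
  exact Finset.sum_congr rfl fun k _ => mul_comm _ _

/-- The weights in the recursion for the coefficients of a solution of `E g'' = A g' + B g`. -/
def frobeniusWeight (E A B : ℂ[X]) (m k : ℕ) : ℂ :=
  E.coeff (m + 2 - k) * (k * (k - 1)) - A.coeff (m + 1 - k) * k - B.coeff (m - k)

/-- Since `E` vanishes at `0`, the coefficient of index `m + 2` drops out. The one of index `m + 1`
carries the indicial factor, so the equation is a recursion wherever this factor is non-zero. -/
lemma coeff_operator (E A B : ℂ[X]) (hE : E.coeff 0 = 0) (s : PowerSeries ℂ) (m : ℕ) :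
    PowerSeries.coeff m ((E : PowerSeries ℂ) * PowerSeries.derivative ℂ (PowerSeries.derivative ℂ s)
        - (A : PowerSeries ℂ) * PowerSeries.derivative ℂ s - (B : PowerSeries ℂ) * s)
      = ∑ k ∈ Finset.range (m + 1), frobeniusWeight E A B m k * PowerSeries.coeff k s
        + (m + 1) * (E.coeff 1 * m - A.coeff 0) * PowerSeries.coeff (m + 1) s := by
  have h1 : PowerSeries.coeff m ((E : PowerSeries ℂ) *
      PowerSeries.derivative ℂ (PowerSeries.derivative ℂ s))
      = ∑ k ∈ Finset.range (m + 1), E.coeff (m + 2 - k) * (k * (k - 1)) * PowerSeries.coeff k s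
        + (m + 1) * (E.coeff 1 * m) * PowerSeries.coeff (m + 1) s := by
    have e : ∑ k ∈ Finset.range (m + 3),
        E.coeff (m + 2 - k) * ((k : ℂ) * (k - 1)) * PowerSeries.coeff k s
        = PowerSeries.coeff m ((E : PowerSeries ℂ) *
          PowerSeries.derivative ℂ (PowerSeries.derivative ℂ s)) := by
      rw [coeff_mul_eq_sum_range, Finset.sum_range_succ', Finset.sum_range_succ']
      simp only [Nat.cast_zero, zero_mul, mul_zero, add_zero, zero_add, Nat.cast_one, sub_self]
      refine Finset.sum_congr rfl fun k _ => ?_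
      rw [PowerSeries.coeff_derivative, PowerSeries.coeff_derivative, Polynomial.coeff_coe,
        show m + 2 - (k + 1 + 1) = m - k by omega]
      push_cast
      ring
    rw [← e, Finset.sum_range_succ, Finset.sum_range_succ, Nat.sub_self, hE,
      show m + 2 - (m + 1) = 1 by omega]
    push_cast
    ring
  have h2 : PowerSeries.coeff m ((A : PowerSeries ℂ) * PowerSeries.derivative ℂ s)
      = ∑ k ∈ Finset.range (m + 1), A.coeff (m + 1 - k) * k * PowerSeries.coeff k s
        + (m + 1) * A.coeff 0 * PowerSeries.coeff (m + 1) s := by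
    have e : ∑ k ∈ Finset.range (m + 2), A.coeff (m + 1 - k) * (k : ℂ) * PowerSeries.coeff k s
        = PowerSeries.coeff m ((A : PowerSeries ℂ) * PowerSeries.derivative ℂ s) := by
      rw [coeff_mul_eq_sum_range, Finset.sum_range_succ']
      simp only [Nat.cast_zero, zero_mul, mul_zero, add_zero]
      refine Finset.sum_congr rfl fun k _ => ?_
      rw [PowerSeries.coeff_derivative, Polynomial.coeff_coe,
        show m + 1 - (k + 1) = m - k by omega]
      push_cast
      ring
    rw [← e, Finset.sum_range_succ, Nat.sub_self]
    push_cast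
    ring
  rw [map_sub, map_sub, h1, h2, coeff_mul_eq_sum_range]
  simp only [frobeniusWeight, sub_mul, Finset.sum_sub_distrib, Polynomial.coeff_coe]
  ring

lemma exists_coeff_bound (q : ℂ[X]) : ∃ b : ℝ, 0 ≤ b ∧ ∀ n, ‖q.coeff n‖ ≤ b := by
  refine ⟨∑ n ∈ q.support, ‖q.coeff n‖, Finset.sum_nonneg fun _ _ => norm_nonneg _, fun n => ?_⟩
  by_cases h : n ∈ q.support
  · exact Finset.single_le_sum (f := fun n => ‖q.coeff n‖) (fun _ _ => norm_nonneg _) h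
  · rw [notMem_support_iff.mp h, norm_zero]
    exact Finset.sum_nonneg fun _ _ => norm_nonneg _

lemma exists_frobeniusWeight_bound (E A B : ℂ[X]) :
    ∃ b : ℝ, 0 ≤ b ∧ ∀ m k, k ≤ m → ‖frobeniusWeight E A B m k‖ ≤ b * (m + 1) ^ 2 := by
  obtain ⟨b₁, h₁, hE⟩ := exists_coeff_bound E
  obtain ⟨b₂, h₂, hA⟩ := exists_coeff_bound A
  obtain ⟨b₃, h₃, hB⟩ := exists_coeff_bound B
  refine ⟨b₁ + b₂ + b₃, by positivity, fun m k hk => ?_⟩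
  have hk' : (k : ℝ) ≤ m := by exact_mod_cast hk
  have hk0 : (0 : ℝ) ≤ k := k.cast_nonneg
  have n1 : ‖(k : ℂ) * (k - 1)‖ ≤ ((m : ℝ) + 1) ^ 2 := by
    rw [norm_mul, Complex.norm_natCast]
    have : ‖(k : ℂ) - 1‖ ≤ k + 1 := by
      refine (norm_sub_le _ _).trans ?_
      simp
    calc (k : ℝ) * ‖(k : ℂ) - 1‖ ≤ (m + 1) * (m + 1) := by
          apply mul_le_mul <;> first | positivity | linarith
      _ = _ := by ring
  have n2 : ‖(k : ℂ)‖ ≤ ((m : ℝ) + 1) ^ 2 := by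
    rw [Complex.norm_natCast]
    nlinarith
  have n3 : (1 : ℝ) ≤ ((m : ℝ) + 1) ^ 2 := one_le_pow₀ (by linarith)
  calc ‖frobeniusWeight E A B m k‖
      ≤ ‖E.coeff (m + 2 - k) * (k * (k - 1))‖ + ‖A.coeff (m + 1 - k) * k‖ + ‖B.coeff (m - k)‖ :=
        (norm_sub_le _ _).trans (add_le_add_left (norm_sub_le _ _) _)
    _ ≤ b₁ * (m + 1) ^ 2 + b₂ * (m + 1) ^ 2 + b₃ * (m + 1) ^ 2 := by
        rw [norm_mul, norm_mul _ (k : ℂ)]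
        refine add_le_add (add_le_add ?_ ?_) ?_
        · exact mul_le_mul (hE _) n1 (norm_nonneg _) h₁
        · exact mul_le_mul (hA _) n2 (norm_nonneg _) h₂
        · exact (hB _).trans (le_mul_of_one_le_right h₃ n3)
    _ = _ := by ring

/-- At a regular singular point with exponents `0` and `l + 1`, a solution up to order `l + 1`
extends to a convergent one. -/
theorem exists_frobenius_solution (E A B : ℂ[X]) (l : ℕ) (hE0 : E.coeff 0 = 0)
    (hE1 : E.coeff 1 ≠ 0) (hA0 : A.coeff 0 = l * E.coeff 1) (p : ℂ[X])
    (hp : X ^ (l + 1) ∣ E * derivative (derivative p) - A * derivative p - B * p) :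
    ∃ (g : ℂ → ℂ) (s : PowerSeries ℂ), HasPowerSeries g s ∧
      (∀ n, n < l + 2 → PowerSeries.coeff n s = p.coeff n) ∧
      ∀ᶠ t in 𝓝 0, E.eval t * deriv (deriv g) t = A.eval t * deriv g t + B.eval t * g t := by
  -- The terms up to index `l + 1` are copied from `p`: the recursion cannot determine the term of
  -- index `l + 1`, where the indicial factor vanishes.
  set c : ℕ → ℂ := frobeniusSeq (l + 2) p.coeff fun n k =>
    -frobeniusWeight E A B (n - 1) k / (n * (E.coeff 1 * (n - 1) - A.coeff 0)) with hc
  have hcl : ∀ n, n < l + 2 → c n = p.coeff n := by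
    intro n hn
    rw [hc, frobeniusSeq, if_pos hn]
  have hcs : ∀ m, l + 1 ≤ m → c (m + 1) = ∑ k ∈ Finset.range (m + 1),
      -frobeniusWeight E A B m k / ((m + 1) * (E.coeff 1 * m - A.coeff 0)) * c k := by
    intro m hm
    conv_lhs => rw [hc, frobeniusSeq, if_neg (by omega)]
    rw [Finset.sum_range]
    push_cast
    simp only [add_sub_cancel_right]
    rfl
  have hden : ∀ m : ℕ, ((m : ℂ) + 1) * (E.coeff 1 * m - A.coeff 0)
      = E.coeff 1 * ((m + 1) * (m - l)) := by
    intro m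
    rw [hA0]
    ring
  set s : PowerSeries ℂ := PowerSeries.mk c with hs
  have hsc : ∀ n, PowerSeries.coeff n s = c n := fun n => PowerSeries.coeff_mk _ _
  obtain ⟨b, hb, hw⟩ := exists_frobeniusWeight_bound E A B
  have hEpos : 0 < ‖E.coeff 1‖ := norm_pos_iff.mpr hE1
  obtain ⟨M, hM⟩ := norm_le_of_recursion c (l + 2) (b * (l + 2) / ‖E.coeff 1‖) (by positivity)
    (by
      intro n hn
      obtain ⟨m, rfl⟩ : ∃ m, n = m + 1 := ⟨n - 1, by omega⟩
      rw [hcs m (by omega), Finset.mul_sum]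
      refine (norm_sum_le _ _).trans (Finset.sum_le_sum fun k hk => ?_)
      rw [norm_mul]
      refine mul_le_mul_of_nonneg_right ?_ (norm_nonneg _)
      have hlm : (l : ℝ) + 1 ≤ m := by exact_mod_cast (by omega : l + 1 ≤ m)
      have hden' : ‖((m : ℂ) + 1) * (E.coeff 1 * m - A.coeff 0)‖
          = ‖E.coeff 1‖ * ((m + 1) * (m - l)) := by
        rw [hden, norm_mul]
        congr 1
        have : ((m : ℂ) + 1) * (m - l) = (((m + 1) * (m - l) : ℝ) : ℂ) := by push_cast; ring
        rw [this, Complex.norm_real, Real.norm_of_nonneg]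
        exact mul_nonneg (by positivity) (by linarith)
      have hl0 : (0 : ℝ) ≤ l := l.cast_nonneg
      have hml : (0 : ℝ) < m - l := by linarith
      rw [norm_div, norm_neg, hden', div_le_div_iff₀ (by positivity) hEpos]
      have h1 := hw m k (Nat.lt_succ_iff.mp (Finset.mem_range.mp hk))
      -- This is an equality at `m = l + 1`, and the right side grows faster; it explains the
      -- constant `l + 2` in the growth rate.
      have h2 : (m : ℝ) + 1 ≤ (l + 2) * (m - l) := by nlinarith
      calc ‖frobeniusWeight E A B m k‖ * ‖E.coeff 1‖
          ≤ b * ((m + 1) * (m + 1)) * ‖E.coeff 1‖ := by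
            rw [← pow_two]; gcongr
        _ ≤ b * ((m + 1) * ((l + 2) * (m - l))) * ‖E.coeff 1‖ := by gcongr
        _ = _ := by ring)
  obtain ⟨g, hg⟩ := exists_hasPowerSeries s M _ (by positivity) (fun n => (hsc n).symm ▸ hM n)
  refine ⟨g, s, hg, fun n hn => (hsc n).trans (hcl n hn), ?_⟩
  have hop : (E : PowerSeries ℂ) * PowerSeries.derivative ℂ (PowerSeries.derivative ℂ s)
        - (A : PowerSeries ℂ) * PowerSeries.derivative ℂ s - (B : PowerSeries ℂ) * s = 0 := by
    ext m
    rw [coeff_operator E A B hE0, map_zero]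
    rcases lt_or_ge m (l + 1) with hm | hm
    -- For `m ≤ l` the coefficient involves only terms of index at most `l + 1`, where the series
    -- agrees with `p`. The resonant order `m = l` is covered here.
    · have hpm : (E * derivative (derivative p) - A * derivative p - B * p).coeff m = 0 := by
        obtain ⟨q, hq⟩ := hp
        rw [hq, coeff_X_pow_mul', if_neg (by omega)]
      have h := coeff_operator E A B hE0 (p : PowerSeries ℂ) m
      rw [PowerSeries.derivative_coe, PowerSeries.derivative_coe, ← Polynomial.coe_mul,
        ← Polynomial.coe_mul, ← Polynomial.coe_mul, ← Polynomial.coe_sub, ← Polynomial.coe_sub,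
        Polynomial.coeff_coe, hpm] at h
      rw [h, hsc, hcl _ (by omega), Polynomial.coeff_coe]
      congr 1
      refine Finset.sum_congr rfl fun k hk => ?_
      have := Finset.mem_range.mp hk
      rw [hsc, hcl _ (by omega), Polynomial.coeff_coe]
    · have hne : ((m : ℂ) + 1) * (E.coeff 1 * m - A.coeff 0) ≠ 0 := by
        rw [hden]
        refine mul_ne_zero hE1 (mul_ne_zero (by exact_mod_cast m.succ_ne_zero) ?_)
        rw [sub_ne_zero]
        exact_mod_cast (by omega : m ≠ l)
      rw [hsc, hcs m hm, Finset.mul_sum, ← Finset.sum_add_distrib]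
      refine Finset.sum_eq_zero fun k _ => ?_
      rw [hsc, ← mul_assoc, mul_div_cancel₀ _ hne]
      ring
  have h := ((hg.deriv.deriv.poly_mul E).sub (hg.deriv.poly_mul A)).sub (hg.poly_mul B)
  rw [hop] at h
  filter_upwards [h] with t ht
  simp only [map_zero, zero_mul] at ht
  have h0 := ht.unique hasSum_zero
  linear_combination h0

end Frobenius

/-! ### Linear differential equations of second order without logarithmic solutions -/

section ODE

variable (D A B : ℂ[X])

/-- `g` represents the germ at `x` of a holomorphic solution of `D g'' = A g' + B g`. -/
def IsODESolutionAt (g : ℂ → ℂ) (x : ℂ) : Prop :=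
  AnalyticAt ℂ g x ∧
    ∀ᶠ t in 𝓝 x, D.eval t * deriv (deriv g) t = A.eval t * deriv g t + B.eval t * g t

variable {D A B}

lemma analyticAt_eval (q : ℂ[X]) (x : ℂ) : AnalyticAt ℂ (fun t => q.eval t) x :=
  AnalyticAt.aeval_polynomial analyticAt_id q

lemma IsODESolutionAt.congr {g h : ℂ → ℂ} {x : ℂ} (hg : IsODESolutionAt D A B g x)
    (hgh : g =ᶠ[𝓝 x] h) : IsODESolutionAt D A B h x := by
  refine ⟨hg.1.congr hgh, ?_⟩
  filter_upwards [hg.2, hgh, hgh.deriv, hgh.deriv.deriv] with t h1 h2 h3 h4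
  rw [← h2, ← h3, ← h4, h1]

lemma IsODESolutionAt.of_preconnected {G : ℂ → ℂ} {U : Set ℂ} (hU : IsOpen U)
    (hc : IsPreconnected U) (hG : AnalyticOnNhd ℂ G U) {x y : ℂ} (hx : x ∈ U) (hy : y ∈ U)
    (h : IsODESolutionAt D A B G x) : IsODESolutionAt D A B G y := by
  refine ⟨hG y hy, ?_⟩
  have h1 : AnalyticOnNhd ℂ (fun t => D.eval t * deriv (deriv G) t) U := fun t ht =>
    (analyticAt_eval D t).mul (hG t ht).deriv.deriv
  have h2 : AnalyticOnNhd ℂ (fun t => A.eval t * deriv G t + B.eval t * G t) U := fun t ht =>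
    ((analyticAt_eval A t).mul (hG t ht).deriv).add ((analyticAt_eval B t).mul (hG t ht))
  have h3 := h1.eqOn_of_preconnected_of_eventuallyEq h2 hc hx h.2
  filter_upwards [hU.mem_nhds hy] with t ht using h3 ht

/-- The two solutions start from `p`, for the exponent `0`, and from `X^(l+1)`, for the exponent `l
+ 1`; the latter always solves the equation to the required order because `l + 1` is an indicial
root. -/
lemma exists_pair_at_zero (E A B : ℂ[X]) (l : ℕ) (hE0 : E.coeff 0 = 0) (hE1 : E.coeff 1 ≠ 0)
    (hA0 : A.coeff 0 = l * E.coeff 1) (p : ℂ[X]) (hp0 : p.coeff 0 ≠ 0)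
    (hp : X ^ (l + 1) ∣ E * derivative (derivative p) - A * derivative p - B * p) :
    ∃ g₀ g₁, IsODESolutionAt E A B g₀ 0 ∧ IsODESolutionAt E A B g₁ 0 ∧ g₀ 0 ≠ 0 ∧ g₁ 0 = 0 ∧
      ¬ ∀ᶠ t in 𝓝 0, g₁ t = 0 := by
  obtain ⟨g₀, s₀, h₀, hs₀, hg₀⟩ := exists_frobenius_solution E A B l hE0 hE1 hA0 p hp
  obtain ⟨E', hE'⟩ : X ∣ E := X_dvd_iff.mpr hE0
  have hq : X ^ (l + 1) ∣ E * derivative (derivative (X ^ (l + 1) : ℂ[X]))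
      - A * derivative (X ^ (l + 1)) - B * X ^ (l + 1) := by
    have hE'0 : E'.coeff 0 = E.coeff 1 := by rw [hE', coeff_X_mul]
    have h1 : X ∣ C (l : ℂ) * E' - A := by
      rw [X_dvd_iff, coeff_sub, coeff_C_mul, hE'0, hA0, sub_self]
    obtain ⟨F, hF⟩ := h1
    refine ⟨C ((l : ℂ) + 1) * F - B, ?_⟩
    have hd1 : derivative (X ^ (l + 1) : ℂ[X]) = C ((l : ℂ) + 1) * X ^ l := by
      rw [derivative_X_pow]
      simp
    have hd2 : X * derivative (derivative (X ^ (l + 1) : ℂ[X]))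
        = C ((l : ℂ) + 1) * (C (l : ℂ) * X ^ l) := by
      rw [hd1, derivative_C_mul, derivative_X_pow]
      rcases l with _ | l
      · simp
      · simp
        ring
    calc E * derivative (derivative (X ^ (l + 1) : ℂ[X]))
      - A * derivative (X ^ (l + 1)) - B * X ^ (l + 1)
        = E' * (X * derivative (derivative (X ^ (l + 1) : ℂ[X])))
          - A * derivative (X ^ (l + 1)) - B * X ^ (l + 1) := by rw [hE']; ring
      _ = C ((l : ℂ) + 1) * X ^ l * (C (l : ℂ) * E' - A) - B * X ^ (l + 1) := by
        rw [hd2, hd1]; ring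
      _ = _ := by rw [hF]; ring
  obtain ⟨g₁, s₁, h₁, hs₁, hg₁⟩ := exists_frobenius_solution E A B l hE0 hE1 hA0 _ hq
  refine ⟨g₀, g₁, ⟨h₀.analyticAt, hg₀⟩, ⟨h₁.analyticAt, hg₁⟩, ?_, ?_, fun h => ?_⟩
  · rw [h₀.apply_zero, hs₀ 0 (by omega)]
    exact hp0
  · rw [h₁.apply_zero, hs₁ 0 (by omega)]
    simp
  · have h2 := hs₁ (l + 1) (by omega)
    rw [h₁.eq_zero_of_eventually h] at h2
    simp at h2

/-- Near `b` the equation `D g'' = A g' + B g` has two solutions, holomorphic at `b` and linearly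
independent. -/
def HasRegularPair (D A B : ℂ[X]) (b : ℂ) : Prop :=
  ∃ g₀ g₁, IsODESolutionAt D A B g₀ b ∧ IsODESolutionAt D A B g₁ b ∧ g₀ b ≠ 0 ∧ g₁ b = 0 ∧
      ¬ ∀ᶠ t in 𝓝 b, g₁ t = 0

lemma tendsto_sub_nhds_zero (b : ℂ) : Filter.Tendsto (fun t => t - b) (𝓝 b) (𝓝 0) := by
  have : Filter.Tendsto (fun t => t - b) (𝓝 b) (𝓝 (b - b)) :=
    (continuous_id.sub continuous_const).tendsto b
  rwa [sub_self] at this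

lemma IsODESolutionAt.shift {g : ℂ → ℂ} {b : ℂ}
    (h : IsODESolutionAt (taylor b D) (taylor b A) (taylor b B) g 0) :
    IsODESolutionAt D A B (fun t => g (t - b)) b := by
  refine ⟨?_, ?_⟩
  · have h1 : AnalyticAt ℂ g (b - b) := by rw [sub_self]; exact h.1
    exact h1.fun_comp (f := fun t => t - b) (by fun_prop)
  · filter_upwards [(tendsto_sub_nhds_zero b).eventually h.2] with t ht
    have e1 : deriv (fun t => g (t - b)) = fun t => deriv g (t - b) :=
      funext fun t => deriv_comp_sub_const _ _ _
    have e2 : deriv (fun t => deriv g (t - b)) t = deriv (deriv g) (t - b) :=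
      deriv_comp_sub_const _ _ _
    rw [e1, e2]
    simpa [taylor_eval] using ht

lemma HasRegularPair.shift {b : ℂ} (h : HasRegularPair (taylor b D) (taylor b A) (taylor b B) 0) :
    HasRegularPair D A B b := by
  obtain ⟨g₀, g₁, h₀, h₁, h2, h3, h4⟩ := h
  refine ⟨_, _, h₀.shift, h₁.shift, by simpa using h2, by simpa using h3, fun h5 => h4 ?_⟩
  have : Filter.Tendsto (fun t => t + b) (𝓝 0) (𝓝 b) := by
    have : Filter.Tendsto (fun t => t + b) (𝓝 0) (𝓝 (0 + b)) :=
      (continuous_id.add continuous_const).tendsto 0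
    rwa [zero_add] at this
  filter_upwards [this.eventually h5] with t ht
  simpa using ht

lemma hasRegularPair_of_truncated (b : ℂ) (l : ℕ) (hD0 : D.eval b = 0)
    (hD1 : (derivative D).eval b ≠ 0) (hA : A.eval b = l * (derivative D).eval b) (p : ℂ[X])
    (hp0 : p.eval b ≠ 0) (hp : (X - C b) ^ (l + 1) ∣
      D * derivative (derivative p) - A * derivative p - B * p) : HasRegularPair D A B b := by
  refine HasRegularPair.shift (exists_pair_at_zero _ _ _ l ?_ ?_ ?_ (taylor b p) ?_ ?_)
  · rwa [taylor_coeff_zero]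
  · rwa [taylor_coeff_one]
  · rw [taylor_coeff_zero, taylor_coeff_one, hA]
  · rwa [taylor_coeff_zero]
  · obtain ⟨q, hq⟩ := hp
    refine ⟨taylor b q, ?_⟩
    have h := congrArg (taylor b) hq
    have hd : ∀ f : ℂ[X], derivative (taylor b f) = taylor b (derivative f) := by
      intro f
      simp [taylor_apply, derivative_comp]
    rw [hd, hd, ← taylor_mul, ← taylor_mul, ← taylor_mul, ← map_sub, ← map_sub, h, taylor_mul]
    simp [taylor_apply]

/-- Multiplying the equation by the local coordinate makes an ordinary point a regular singular one
with exponents `0` and `1`, where the constant `1` is a truncated solution. -/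
lemma hasRegularPair_of_ne_zero (b : ℂ) (hD : D.eval b ≠ 0) : HasRegularPair D A B b := by
  refine HasRegularPair.shift ?_
  obtain ⟨g₀, g₁, h₀, h₁, h2⟩ := exists_pair_at_zero (X * taylor b D) (X * taylor b A)
    (X * taylor b B) 0 (by simp) (by rw [coeff_X_mul, taylor_coeff_zero]; exact hD) (by simp) 1
    (by simp) ⟨-taylor b B, by simp⟩
  have key : ∀ g, IsODESolutionAt (X * taylor b D) (X * taylor b A) (X * taylor b B) g 0 →
      IsODESolutionAt (taylor b D) (taylor b A) (taylor b B) g 0 := by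
    intro g hg
    have h1 : AnalyticAt ℂ (fun t => (taylor b D).eval t * deriv (deriv g) t) 0 :=
      (analyticAt_eval _ _).mul hg.1.deriv.deriv
    have h2 : AnalyticAt ℂ (fun t => (taylor b A).eval t * deriv g t + (taylor b B).eval t * g t) 0 :=
      ((analyticAt_eval _ _).mul hg.1.deriv).add ((analyticAt_eval _ _).mul hg.1)
    refine ⟨hg.1, (h1.frequently_eq_iff_eventually_eq h2).mp (Filter.Eventually.frequently ?_)⟩
    filter_upwards [hg.2.filter_mono nhdsWithin_le_nhds, self_mem_nhdsWithin] with t ht ht0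
    simp only [eval_mul, eval_X] at ht
    exact mul_left_cancel₀ ht0 (by linear_combination ht)
  exact ⟨g₀, g₁, key _ h₀, key _ h₁, h2⟩

/-- The derivative of a Wronskian. -/
lemma hasDerivAt_wronskian {u v : ℂ → ℂ} {t : ℂ} (hu : AnalyticAt ℂ u t) (hv : AnalyticAt ℂ v t)
    (hDt : D.eval t ≠ 0)
    (hu2 : D.eval t * deriv (deriv u) t = A.eval t * deriv u t + B.eval t * u t)
    (hv2 : D.eval t * deriv (deriv v) t = A.eval t * deriv v t + B.eval t * v t) :
    HasDerivAt (fun t => u t * deriv v t - v t * deriv u t)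
      (A.eval t / D.eval t * (u t * deriv v t - v t * deriv u t)) t := by
  have h := (hu.differentiableAt.hasDerivAt.mul hv.deriv.differentiableAt.hasDerivAt).sub
    (hv.differentiableAt.hasDerivAt.mul hu.deriv.differentiableAt.hasDerivAt)
  refine h.congr_deriv ?_
  field_simp
  linear_combination u t * hv2 - v t * hu2

/-- Two solutions on `ball b r` that span the germs of solutions at every point of it. -/
lemma HasRegularPair.exists_ball (hD : D ≠ 0) {b : ℂ} (h : HasRegularPair D A B b) :
    ∃ r > 0, ∃ g₀ g₁, AnalyticOnNhd ℂ g₀ (Metric.ball b r) ∧ AnalyticOnNhd ℂ g₁ (Metric.ball b r) ∧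
      (∀ x ∈ Metric.ball b r, IsODESolutionAt D A B g₀ x ∧ IsODESolutionAt D A B g₁ x) ∧
      (∀ x ∈ Metric.ball b r, ∀ c₀ c₁ : ℂ, (∀ᶠ t in 𝓝 x, c₀ * g₀ t + c₁ * g₁ t = 0) →
        c₀ = 0 ∧ c₁ = 0) ∧
      ∀ x ∈ Metric.ball b r, ∀ g, IsODESolutionAt D A B g x →
        ∃ c₀ c₁ : ℂ, ∀ᶠ t in 𝓝 x, g t = c₀ * g₀ t + c₁ * g₁ t := by
  obtain ⟨g₀, g₁, h₀, h₁, hg₀, hg₁, hne⟩ := h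
  set W : ℂ → ℂ := fun t => g₀ t * deriv g₁ t - g₁ t * deriv g₀ t with hW
  have hWa : AnalyticAt ℂ W b := (h₀.1.mul h₁.1.deriv).sub (h₁.1.mul h₀.1.deriv)
  -- If the Wronskian vanished near `b`, then `g₁ / g₀` would be constant there, with value `0` at
  -- `b`, contradicting that `g₁` is not identically zero.
  have hWne : ∀ᶠ t in 𝓝[≠] b, W t ≠ 0 := by
    refine hWa.eventually_eq_zero_or_eventually_ne_zero.resolve_left fun hW0 => hne ?_
    have hev : ∀ᶠ t in 𝓝 b, W t = 0 ∧ AnalyticAt ℂ g₀ t ∧ AnalyticAt ℂ g₁ t ∧ g₀ t ≠ 0 :=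
      hW0.and (h₀.1.eventually_analyticAt.and (h₁.1.eventually_analyticAt.and
        (h₀.1.continuousAt.eventually_ne hg₀)))
    obtain ⟨ε, hε, hball⟩ := Metric.eventually_nhds_iff_ball.mp hev
    have hd : ∀ t ∈ Metric.ball b ε, HasDerivAt (fun t => g₁ t / g₀ t) 0 t := by
      intro t ht
      obtain ⟨w0, a0, a1, n0⟩ := hball t ht
      refine (a1.differentiableAt.hasDerivAt.div a0.differentiableAt.hasDerivAt n0).congr_deriv ?_
      rw [div_eq_zero_iff]
      left
      simp only [hW] at w0
      linear_combination w0
    filter_upwards [Metric.ball_mem_nhds b hε] with t ht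
    have := Metric.isOpen_ball.is_const_of_deriv_eq_zero (convex_ball b ε).isPreconnected
      (fun t ht => (hd t ht).differentiableAt.differentiableWithinAt)
      (fun t ht => (hd t ht).deriv) ht (Metric.mem_ball_self hε)
    simp only [hg₁, zero_div] at this
    exact (div_eq_zero_iff.mp this).resolve_right (hball t ht).2.2.2
  have hDne : ∀ᶠ t in 𝓝[≠] b, D.eval t ≠ 0 := by
    refine (analyticAt_eval D b).eventually_eq_zero_or_eventually_ne_zero.resolve_left fun h0 => hD ?_
    exact Polynomial.eq_zero_of_infinite_isRoot D
      ((infinite_of_mem_nhds b h0).mono fun t ht => ht)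
  have hev : ∀ᶠ t in 𝓝 b, AnalyticAt ℂ g₀ t ∧ AnalyticAt ℂ g₁ t ∧
      (D.eval t * deriv (deriv g₀) t = A.eval t * deriv g₀ t + B.eval t * g₀ t) ∧
      (D.eval t * deriv (deriv g₁) t = A.eval t * deriv g₁ t + B.eval t * g₁ t) ∧
      (t ≠ b → W t ≠ 0) ∧ (t ≠ b → D.eval t ≠ 0) :=
    h₀.1.eventually_analyticAt.and (h₁.1.eventually_analyticAt.and (h₀.2.and (h₁.2.and
      ((eventually_nhdsWithin_iff.mp hWne).and (eventually_nhdsWithin_iff.mp hDne)))))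
  obtain ⟨r, hr, hball⟩ := Metric.eventually_nhds_iff_ball.mp hev
  have ha₀ : AnalyticOnNhd ℂ g₀ (Metric.ball b r) := fun t ht => (hball t ht).1
  have ha₁ : AnalyticOnNhd ℂ g₁ (Metric.ball b r) := fun t ht => (hball t ht).2.1
  have hpre := (convex_ball b r).isPreconnected
  refine ⟨r, hr, g₀, g₁, ha₀, ha₁, fun x hx => ⟨?_, ?_⟩, ?_, ?_⟩
  · exact h₀.of_preconnected Metric.isOpen_ball hpre ha₀ (Metric.mem_ball_self hr) hx
  · exact h₁.of_preconnected Metric.isOpen_ball hpre ha₁ (Metric.mem_ball_self hr) hx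
  · intro x hx c₀ c₁ hc
    have hco : AnalyticOnNhd ℂ (fun t => c₀ * g₀ t + c₁ * g₁ t) (Metric.ball b r) := fun t ht =>
      (analyticAt_const.mul (ha₀ t ht)).add (analyticAt_const.mul (ha₁ t ht))
    have hz := hco.eqOn_of_preconnected_of_eventuallyEq (g := fun _ => 0)
      (fun t _ => analyticAt_const) hpre hx hc
    have hc₀ : c₀ = 0 := by
      have := hz (Metric.mem_ball_self hr)
      simp only [hg₁, mul_zero, add_zero, mul_eq_zero] at this
      exact this.resolve_right hg₀
    refine ⟨hc₀, ?_⟩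
    by_contra hc₁
    refine hne ?_
    filter_upwards [Metric.ball_mem_nhds b hr] with t ht
    have := hz ht
    simp only [hc₀, zero_mul, zero_add, mul_eq_zero] at this
    exact this.resolve_left hc₁
  · intro x hx g hg
    have hev2 : ∀ᶠ t in 𝓝 x, t ∈ Metric.ball b r ∧ AnalyticAt ℂ g t ∧
        (D.eval t * deriv (deriv g) t = A.eval t * deriv g t + B.eval t * g t) :=
      (show ∀ᶠ t in 𝓝 x, t ∈ Metric.ball b r from Metric.isOpen_ball.mem_nhds hx).and (hg.1.eventually_analyticAt.and hg.2)
    obtain ⟨δ, hδ, hδb⟩ := Metric.eventually_nhds_iff_ball.mp hev2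
    -- The point `x` may be `b` itself, where `D` or the Wronskian can vanish. The coefficients are
    -- therefore found near a neighbouring point, and the identity theorem carries the relation back
    -- to `x`.
    obtain ⟨x', hx', hx'b⟩ : ∃ x' ∈ Metric.ball x δ, x' ≠ b := by
      by_contra! hcon
      have hinf := infinite_of_mem_nhds x (Metric.ball_mem_nhds x hδ)
      exact hinf ((Set.finite_singleton b).subset hcon)
    obtain ⟨η, hη, hηb⟩ : ∃ η > 0, Metric.ball x' η ⊆ Metric.ball x δ ∩ {b}ᶜ :=
      Metric.isOpen_iff.mp (Metric.isOpen_ball.inter isOpen_compl_singleton) x' ⟨hx', hx'b⟩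
    -- All Wronskians solve `w' = (A/D) w`, so their quotients are constant; by Cramer's rule these
    -- quotients are the coefficients of `g`.
    have hquot : ∀ u v, AnalyticOnNhd ℂ u (Metric.ball x δ) → AnalyticOnNhd ℂ v (Metric.ball x δ) →
        (∀ t ∈ Metric.ball x δ,
          D.eval t * deriv (deriv u) t = A.eval t * deriv u t + B.eval t * u t) →
        (∀ t ∈ Metric.ball x δ,
          D.eval t * deriv (deriv v) t = A.eval t * deriv v t + B.eval t * v t) →
        ∃ c, ∀ t ∈ Metric.ball x' η, (u t * deriv v t - v t * deriv u t) / W t = c := by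
      intro u v hu hv hu2 hv2
      have hd : ∀ t ∈ Metric.ball x' η,
          HasDerivAt (fun t => (u t * deriv v t - v t * deriv u t) / W t) 0 t := by
        intro t ht
        obtain ⟨htx, htb⟩ := hηb ht
        obtain ⟨a0, a1, e0, e1, w, d⟩ := hball t (hδb t htx).1
        have h1 := hasDerivAt_wronskian (hu t htx) (hv t htx) (d htb) (hu2 t htx) (hv2 t htx)
        have h2 := hasDerivAt_wronskian a0 a1 (d htb) e0 e1
        refine (h1.div h2 (w htb)).congr_deriv ?_
        rw [div_eq_zero_iff]
        left
        ring
      exact Metric.isOpen_ball.exists_is_const_of_deriv_eq_zero (convex_ball x' η).isPreconnected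
        (fun t ht => (hd t ht).differentiableAt.differentiableWithinAt)
        (fun t ht => (hd t ht).deriv)
    have hga : AnalyticOnNhd ℂ g (Metric.ball x δ) := fun t ht => (hδb t ht).2.1
    have hg₀a : AnalyticOnNhd ℂ g₀ (Metric.ball x δ) := fun t ht => ha₀ t (hδb t ht).1
    have hg₁a : AnalyticOnNhd ℂ g₁ (Metric.ball x δ) := fun t ht => ha₁ t (hδb t ht).1
    obtain ⟨c₀, hc₀⟩ := hquot g g₁ hga hg₁a (fun t ht => (hδb t ht).2.2)
      (fun t ht => (hball t (hδb t ht).1).2.2.2.1)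
    obtain ⟨c₁, hc₁⟩ := hquot g₀ g hg₀a hga (fun t ht => (hball t (hδb t ht).1).2.2.1)
      (fun t ht => (hδb t ht).2.2)
    refine ⟨c₀, c₁, ?_⟩
    have hco : AnalyticOnNhd ℂ (fun t => c₀ * g₀ t + c₁ * g₁ t) (Metric.ball x δ) := fun t ht =>
      (analyticAt_const.mul (hg₀a t ht)).add (analyticAt_const.mul (hg₁a t ht))
    have heq : g =ᶠ[𝓝 x'] fun t => c₀ * g₀ t + c₁ * g₁ t := by
      filter_upwards [Metric.ball_mem_nhds x' hη] with t ht
      have hWt := (hball t (hδb t (hηb ht).1).1).2.2.2.2.1 (hηb ht).2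
      rw [← hc₀ t ht, ← hc₁ t ht]
      field_simp
      simp only [hW]
      ring
    have hall := hga.eqOn_of_preconnected_of_eventuallyEq hco (convex_ball x δ).isPreconnected hx' heq
    filter_upwards [Metric.ball_mem_nhds x hδ] with t ht using hall ht

/-! ### Extension of solutions by gluing -/

variable (D A B) in
/-- Every germ of a solution at a point of `U` extends to a holomorphic function on `U`. -/
def ExtendsOn (U : Set ℂ) : Prop :=
  ∀ x ∈ U, ∀ g, IsODESolutionAt D A B g x → ∃ G, AnalyticOnNhd ℂ G U ∧ G =ᶠ[𝓝 x] g

lemma ExtendsOn.mono {U V : Set ℂ} (hUV : U ⊆ V) (hV : ExtendsOn D A B V) : ExtendsOn D A B U := by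
  intro x hx g hg
  obtain ⟨G, hG, hGx⟩ := hV x (hUV hx) g hg
  exact ⟨G, hG.mono hUV, hGx⟩

lemma HasRegularPair.exists_extendsOn_ball (hD : D ≠ 0) {b : ℂ} (h : HasRegularPair D A B b) :
    ∃ r > 0, ExtendsOn D A B (Metric.ball b r) := by
  obtain ⟨r, hr, g₀, g₁, h₀, h₁, -, -, hspan⟩ := h.exists_ball hD
  refine ⟨r, hr, fun x hx g hg => ?_⟩
  obtain ⟨c₀, c₁, hc⟩ := hspan x hx g hg
  refine ⟨fun t => c₀ * g₀ t + c₁ * g₁ t, fun t ht =>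
    (analyticAt_const.mul (h₀ t ht)).add (analyticAt_const.mul (h₁ t ht)), ?_⟩
  filter_upwards [hc] with t ht using ht.symm

/-- Connectedness of the intersection makes two extensions that agree at one point of it agree on
all of it, so that they glue. -/
lemma ExtendsOn.union {U V : Set ℂ} (hUo : IsOpen U) (hVo : IsOpen V) (hUc : IsPreconnected U)
    (hVc : IsPreconnected V) (hne : (U ∩ V).Nonempty) (hc : IsPreconnected (U ∩ V))
    (hU : ExtendsOn D A B U) (hV : ExtendsOn D A B V) : ExtendsOn D A B (U ∪ V) := by
  classical
  have key : ∀ U V : Set ℂ, IsOpen U → IsOpen V → IsPreconnected U → (U ∩ V).Nonempty →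
      IsPreconnected (U ∩ V) → ExtendsOn D A B U → ExtendsOn D A B V →
      ∀ x ∈ U, ∀ g, IsODESolutionAt D A B g x → ∃ G, AnalyticOnNhd ℂ G (U ∪ V) ∧ G =ᶠ[𝓝 x] g := by
    rintro U V hUo hVo hUc ⟨y, hyU, hyV⟩ hc hU hV x hx g hg
    obtain ⟨G, hG, hGx⟩ := hU x hx g hg
    have hGy := (hg.congr hGx.symm).of_preconnected hUo hUc hG hx hyU
    obtain ⟨H, hH, hHy⟩ := hV y hyV G hGy
    have heq : Set.EqOn G H (U ∩ V) := (hG.mono Set.inter_subset_left).eqOn_of_preconnected_of_eventuallyEq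
      (hH.mono Set.inter_subset_right) hc ⟨hyU, hyV⟩ hHy.symm
    have hKG : ∀ t ∈ U, U.piecewise G H =ᶠ[𝓝 t] G := by
      intro t ht
      filter_upwards [hUo.mem_nhds ht] with s hs
      simp [hs]
    have hKH : ∀ t ∈ V, U.piecewise G H =ᶠ[𝓝 t] H := by
      intro t ht
      filter_upwards [hVo.mem_nhds ht] with s hs
      by_cases hsU : s ∈ U
      · simpa [hsU] using heq ⟨hsU, hs⟩
      · simp [hsU]
    refine ⟨U.piecewise G H, ?_, (hKG x hx).trans hGx⟩
    rintro t (ht | ht)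
    · exact (hG t ht).congr (hKG t ht).symm
    · exact (hH t ht).congr (hKH t ht).symm
  rintro x (hx | hx) g hg
  · exact key U V hUo hVo hUc hne hc hU hV x hx g hg
  · rw [Set.union_comm]
    rw [Set.inter_comm] at hne hc
    exact key V U hVo hUo hVc hne hc hV hU x hx g hg

lemma isPreconnected_rect (a b c d : ℝ) : IsPreconnected (Set.Ioo a b ×ℂ Set.Ioo c d) :=
  (((convex_Ioo a b).linear_preimage Complex.reLm).inter
    ((convex_Ioo c d).linear_preimage Complex.imLm)).isPreconnected

lemma isOpen_rect (a b c d : ℝ) : IsOpen (Set.Ioo a b ×ℂ Set.Ioo c d) :=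
  isOpen_Ioo.reProdIm isOpen_Ioo

lemma ExtendsOn.rect_horizontal {a a' b' b c d : ℝ} (h1 : a ≤ a') (h2 : a' < b') (h3 : b' ≤ b)
    (hcd : c < d) (hl : ExtendsOn D A B (Set.Ioo a b' ×ℂ Set.Ioo c d))
    (hr : ExtendsOn D A B (Set.Ioo a' b ×ℂ Set.Ioo c d)) :
    ExtendsOn D A B (Set.Ioo a b ×ℂ Set.Ioo c d) := by
  have hi : (Set.Ioo a b' ×ℂ Set.Ioo c d) ∩ (Set.Ioo a' b ×ℂ Set.Ioo c d)
      = Set.Ioo a' b' ×ℂ Set.Ioo c d := by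
    ext t
    simp only [Set.mem_inter_iff, Complex.mem_reProdIm, Set.mem_Ioo]
    grind
  refine ExtendsOn.mono ?_ (hl.union (isOpen_rect _ _ _ _) (isOpen_rect _ _ _ _)
    (isPreconnected_rect _ _ _ _) (isPreconnected_rect _ _ _ _) ?_ ?_ hr)
  · intro t
    simp only [Set.mem_union, Complex.mem_reProdIm, Set.mem_Ioo]
    grind
  · rw [hi]
    exact ⟨⟨(a' + b') / 2, (c + d) / 2⟩, by
      simp only [Complex.mem_reProdIm, Set.mem_Ioo]; grind⟩
  · rw [hi]
    exact isPreconnected_rect _ _ _ _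

lemma ExtendsOn.rect_vertical {a b c c' d' d : ℝ} (h1 : c ≤ c') (h2 : c' < d') (h3 : d' ≤ d)
    (hab : a < b) (hl : ExtendsOn D A B (Set.Ioo a b ×ℂ Set.Ioo c d'))
    (hr : ExtendsOn D A B (Set.Ioo a b ×ℂ Set.Ioo c' d)) :
    ExtendsOn D A B (Set.Ioo a b ×ℂ Set.Ioo c d) := by
  have hi : (Set.Ioo a b ×ℂ Set.Ioo c d') ∩ (Set.Ioo a b ×ℂ Set.Ioo c' d)
      = Set.Ioo a b ×ℂ Set.Ioo c' d' := by
    ext t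
    simp only [Set.mem_inter_iff, Complex.mem_reProdIm, Set.mem_Ioo]
    grind
  refine ExtendsOn.mono ?_ (hl.union (isOpen_rect _ _ _ _) (isOpen_rect _ _ _ _)
    (isPreconnected_rect _ _ _ _) (isPreconnected_rect _ _ _ _) ?_ ?_ hr)
  · intro t
    simp only [Set.mem_union, Complex.mem_reProdIm, Set.mem_Ioo]
    grind
  · rw [hi]
    exact ⟨⟨(a + b) / 2, (c' + d') / 2⟩, by
      simp only [Complex.mem_reProdIm, Set.mem_Ioo]; grind⟩
  · rw [hi]
    exact isPreconnected_rect _ _ _ _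

/-- An equation all of whose singularities are regular extends its solutions to arbitrarily large
squares. -/
theorem extendsOn_square (hD : D ≠ 0) (h : ∀ b, HasRegularPair D A B b) (M : ℝ) (hM : 0 < M) :
    ExtendsOn D A B (Set.Ioo (-M) M ×ℂ Set.Ioo (-M) M) := by
  choose r hr hball using fun b => (h b).exists_extendsOn_ball hD
  obtain ⟨δ, hδ, hleb⟩ := lebesgue_number_lemma_of_metric
    (s := Set.Icc (-M) M ×ℂ Set.Icc (-M) M) (c := fun b : ℂ => Metric.ball b (r b))
    (isCompact_Icc.reProdIm isCompact_Icc) (fun b => Metric.isOpen_ball)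
    (fun b _ => Set.mem_iUnion.mpr ⟨b, Metric.mem_ball_self (hr b)⟩)
  have hsmall : ∀ a b c d : ℝ, -M ≤ a → a < b → b ≤ M → -M ≤ c → c < d → d ≤ M →
      b - a < δ / 2 → d - c < δ / 2 → ExtendsOn D A B (Set.Ioo a b ×ℂ Set.Ioo c d) := by
    intro a b c d ha hab hb hc hcd hd h1 h2
    obtain ⟨y, hy⟩ := hleb ⟨a, c⟩ (by simp only [Complex.mem_reProdIm, Set.mem_Icc]; grind)
    refine ExtendsOn.mono (fun t ht => hy ?_) (hball y)
    simp only [Complex.mem_reProdIm, Set.mem_Ioo] at ht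
    rw [Metric.mem_ball, dist_eq_norm]
    refine (Complex.norm_le_abs_re_add_abs_im _).trans_lt ?_
    simp only [Complex.sub_re, Complex.sub_im]
    rw [abs_of_pos (by linarith [ht.1.1]), abs_of_pos (by linarith [ht.2.1])]
    linarith [ht.1.2, ht.2.2]
  have hstrip : ∀ n : ℕ, ∀ a b c d : ℝ, -M ≤ a → a < b → b ≤ M → -M ≤ c → c < d → d ≤ M →
      b - a < δ / 2 * (3 / 2) ^ n → d - c < δ / 2 →
      ExtendsOn D A B (Set.Ioo a b ×ℂ Set.Ioo c d) := by
    intro n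
    induction n with
    | zero => simpa using hsmall
    | succ n ih =>
      intro a b c d ha hab hb hc hcd hd h1 h2
      rw [pow_succ] at h1
      -- Two pieces, each two thirds of the width, overlap in the middle third; this is why the
      -- admissible size grows by the factor `3/2`.
      exact ExtendsOn.rect_horizontal (a' := a + (b - a) / 3) (b' := a + 2 * (b - a) / 3)
        (by linarith) (by linarith) (by linarith) hcd
        (ih _ _ _ _ ha (by linarith) (by linarith) hc hcd hd (by linarith) h2)
        (ih _ _ _ _ (by linarith) (by linarith) hb hc hcd hd (by linarith) h2)
  have hlarge : ∀ s : ℝ, ∃ n : ℕ, s < δ / 2 * (3 / 2) ^ n := by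
    intro s
    obtain ⟨n, hn⟩ := pow_unbounded_of_one_lt (s / (δ / 2)) (by norm_num : (1 : ℝ) < 3 / 2)
    exact ⟨n, by rwa [div_lt_iff₀' (by positivity)] at hn⟩
  have hrect : ∀ n : ℕ, ∀ c d : ℝ, -M ≤ c → c < d → d ≤ M → d - c < δ / 2 * (3 / 2) ^ n →
      ExtendsOn D A B (Set.Ioo (-M) M ×ℂ Set.Ioo c d) := by
    intro n
    induction n with
    | zero =>
      intro c d hc hcd hd h1
      obtain ⟨n, hn⟩ := hlarge (M - -M)
      exact hstrip n _ _ _ _ le_rfl (by linarith) le_rfl hc hcd hd hn (by simpa using h1)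
    | succ n ih =>
      intro c d hc hcd hd h1
      rw [pow_succ] at h1
      exact ExtendsOn.rect_vertical (c' := c + (d - c) / 3) (d' := c + 2 * (d - c) / 3)
        (by linarith) (by linarith) (by linarith) (by linarith)
        (ih _ _ hc (by linarith) (by linarith) (by linarith))
        (ih _ _ (by linarith) (by linarith) hd (by linarith))
  obtain ⟨n, hn⟩ := hlarge (M - -M)
  exact hrect n _ _ le_rfl (by linarith) le_rfl hn

end ODE

/-! ### The equation away from the singular points -/

section Potential

variable {N : ℕ} (z : Fin N → ℂ) (lam : Fin N → ℕ) (μ : Fin N → ℂ)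

lemma eval_nodal_ne_zero {t : ℂ} (ht : ∀ i, t ≠ z i) : (nodal z).eval t ≠ 0 := by
  rw [nodal, eval_prod, Finset.prod_ne_zero_iff]
  intro j _
  simpa [sub_eq_zero] using ht j

lemma nodal_ne_zero : nodal z ≠ 0 := (monic_prod_of_monic _ _ fun _ _ => monic_X_sub_C _).ne_zero

lemma eval_nodalErase {t : ℂ} (ht : ∀ i, t ≠ z i) (j : Fin N) :
    (nodalErase z j).eval t = (nodal z).eval t / (t - z j) := by
  rw [nodal_eq z j, eval_mul, eval_sub, eval_X, eval_C, mul_div_cancel_left₀]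
  exact sub_ne_zero.mpr (ht j)

/-- The logarithmic derivative `∑ⱼ λⱼ / (t - zⱼ)` of `∏ⱼ (t - zⱼ)^{λⱼ}`. -/
def logDer (t : ℂ) : ℂ := ∑ j, (lam j : ℂ) / (t - z j)

lemma eval_firstCoeff {t : ℂ} (ht : ∀ i, t ≠ z i) :
    (firstCoeff z lam).eval t = (nodal z).eval t * logDer z lam t := by
  rw [firstCoeff, eval_finsetSum, logDer, Finset.mul_sum]
  refine Finset.sum_congr rfl fun j _ => ?_
  rw [eval_mul, eval_C, eval_nodalErase z ht]
  ring

lemma eval_zerothCoeff {t : ℂ} (ht : ∀ i, t ≠ z i) :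
    (zerothCoeff z lam μ).eval t
      = (nodal z).eval t * ∑ j, (μ j - vacuumEigenvalue z lam j) / (t - z j) := by
  rw [zerothCoeff, eval_finsetSum, Finset.mul_sum]
  refine Finset.sum_congr rfl fun j _ => ?_
  rw [eval_mul, eval_C, eval_nodalErase z ht]
  ring

/-- Pairing `(j, k)` with `(k, j)` and using partial fractions gives the off-diagonal part of the
square of `logDer`. -/
lemma sum_vacuumEigenvalue (hz : Function.Injective z) {t : ℂ} (ht : ∀ i, t ≠ z i) :
    ∑ j, vacuumEigenvalue z lam j / (t - z j)
      = (logDer z lam t ^ 2 - ∑ j, (lam j : ℂ) ^ 2 / (t - z j) ^ 2) / 4 := by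
  have hs : ∀ j, t - z j ≠ 0 := fun j => sub_ne_zero.mpr (ht j)
  set a : Fin N → Fin N → ℂ := fun j k => (z j - z k)⁻¹ * ((lam j : ℂ) * lam k / 2) / (t - z j)
    with ha
  have h1 : ∑ j, vacuumEigenvalue z lam j / (t - z j) = ∑ j, ∑ k, a j k := by
    refine Finset.sum_congr rfl fun j _ => ?_
    rw [vacuumEigenvalue, Finset.sum_div]
    exact Finset.sum_erase _ (show a j j = 0 by simp [ha])
  have h2 : ∀ j k, a j k + a k j = (lam j : ℂ) / (t - z j) * ((lam k : ℂ) / (t - z k)) / 2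
      - if j = k then (lam j : ℂ) ^ 2 / (t - z j) ^ 2 / 2 else 0 := by
    intro j k
    rcases eq_or_ne j k with rfl | hjk
    · simp only [ha, sub_self, inv_zero, zero_mul, zero_div, add_zero, if_true]
      have := hs j
      field_simp
      ring
    · have hjk' : z j - z k ≠ 0 := sub_ne_zero.mpr (hz.ne hjk)
      have h1 := hs j
      have h2 := hs k
      simp only [ha, if_neg hjk, sub_zero]
      rw [← neg_sub (z j) (z k), inv_neg]
      field_simp
      ring
  have h3 : 2 * ∑ j, ∑ k, a j k
      = logDer z lam t ^ 2 / 2 - (∑ j, (lam j : ℂ) ^ 2 / (t - z j) ^ 2) / 2 := by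
    rw [two_mul]
    nth_rewrite 2 [Finset.sum_comm]
    rw [← Finset.sum_add_distrib]
    simp only [← Finset.sum_add_distrib, h2, Finset.sum_sub_distrib, Finset.sum_ite_eq,
      Finset.mem_univ, if_true]
    rw [pow_two, logDer, Finset.sum_mul_sum, Finset.sum_div, Finset.sum_div]
    simp only [Finset.sum_div]
  rw [h1]
  linear_combination h3 / 2

/-- In `λ(λ+2)/4 = λ²/4 + λ/2` the first part combines with the vacuum eigenvalues into `logDer² /
4`. The last two terms are then exactly what conjugation by `weight^(-1/2)` produces. -/
lemma potential_eq (hz : Function.Injective z) {t : ℂ} (ht : ∀ i, t ≠ z i) :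
    potential z lam μ t = (∑ j, (μ j - vacuumEigenvalue z lam j) / (t - z j))
      + logDer z lam t ^ 2 / 4 + (∑ j, (lam j : ℂ) / (t - z j) ^ 2) / 2 := by
  have h := sum_vacuumEigenvalue z lam hz ht
  simp only [sub_div, Finset.sum_sub_distrib, h]
  have h2 : ∑ i, ((lam i : ℂ) * (lam i + 2) / 4) / (t - z i) ^ 2
      = (∑ j, (lam j : ℂ) ^ 2 / (t - z j) ^ 2) / 4 + (∑ j, (lam j : ℂ) / (t - z j) ^ 2) / 2 := by
    rw [Finset.sum_div, Finset.sum_div, ← Finset.sum_add_distrib]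
    refine Finset.sum_congr rfl fun j _ => ?_
    ring
  rw [potential, h2]
  ring

lemma hasDerivAt_logDer {t : ℂ} (ht : ∀ i, t ≠ z i) :
    HasDerivAt (logDer z lam) (-∑ j, (lam j : ℂ) / (t - z j) ^ 2) t := by
  rw [← Finset.sum_neg_distrib]
  refine HasDerivAt.fun_sum fun j _ => ?_
  have h := (((hasDerivAt_id t).sub_const (z j)).inv (sub_ne_zero.mpr (ht j))).const_mul (lam j : ℂ)
  simp only [id] at h
  refine h.congr_deriv ?_
  ring

/-- `∏ⱼ (t - zⱼ)^{λⱼ}`. -/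
def weight (t : ℂ) : ℂ := ∏ j, (t - z j) ^ lam j

lemma weight_ne_zero {t : ℂ} (ht : ∀ i, t ≠ z i) : weight z lam t ≠ 0 :=
  Finset.prod_ne_zero_iff.mpr fun j _ => pow_ne_zero _ (sub_ne_zero.mpr (ht j))

lemma continuous_weight : Continuous (weight z lam) := by
  unfold weight
  fun_prop

lemma differentiable_weight : Differentiable ℂ (weight z lam) := by
  unfold weight
  fun_prop

lemma hasDerivAt_weight {t : ℂ} (ht : ∀ i, t ≠ z i) :
    HasDerivAt (weight z lam) (logDer z lam t * weight z lam t) t := by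
  refine (differentiable_weight z lam t).hasDerivAt.congr_deriv ?_
  have h : logDeriv (weight z lam) t = logDer z lam t := by
    have := logDeriv_prod (s := Finset.univ) (f := fun (j : Fin N) (t : ℂ) => (t - z j) ^ lam j)
      (x := t) (fun j _ => pow_ne_zero _ (sub_ne_zero.mpr (ht j)))
      (fun j _ => by fun_prop)
    have e : weight z lam = fun t => ∏ j, (t - z j) ^ lam j := rfl
    rw [e, this, logDer]
    refine Finset.sum_congr rfl fun j _ => ?_
    rw [logDeriv_fun_pow (by fun_prop)]
    simp [logDeriv_apply, div_eq_mul_inv]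
  rw [← h, logDeriv_apply, div_mul_cancel₀ _ (weight_ne_zero z lam ht)]

lemma eventually_ne_singular {a : ℂ} (ha : ∀ i, a ≠ z i) : ∀ᶠ t in 𝓝 a, ∀ i, t ≠ z i :=
  Filter.eventually_all.mpr fun i => isOpen_ne.mem_nhds (ha i)

/-- The branch near `a` of the `κ`-th power of `t ↦ weight t / weight a` with value `1` at `a`. -/
def twist (κ a t : ℂ) : ℂ := Complex.exp (κ * Complex.log (weight z lam t / weight z lam a))

lemma twist_mul_twist (κ a t : ℂ) : twist z lam κ a t * twist z lam (-κ) a t = 1 := by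
  rw [twist, twist, ← Complex.exp_add]
  simp

lemma twist_ne_zero (κ a t : ℂ) : twist z lam κ a t ≠ 0 := Complex.exp_ne_zero _

lemma eventually_weight_div_mem_slitPlane {a : ℂ} (ha : ∀ i, a ≠ z i) :
    ∀ᶠ t in 𝓝 a, weight z lam t / weight z lam a ∈ Complex.slitPlane := by
  have : ContinuousAt (fun t => weight z lam t / weight z lam a) a :=
    (continuous_weight z lam).continuousAt.div_const _
  refine this.eventually_mem (Complex.isOpen_slitPlane.mem_nhds ?_)
  rw [div_self (weight_ne_zero z lam ha)]
  exact Complex.one_mem_slitPlane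

lemma eventually_hasDerivAt_twist (κ : ℂ) {a : ℂ} (ha : ∀ i, a ≠ z i) :
    ∀ᶠ t in 𝓝 a, HasDerivAt (twist z lam κ a) (κ * logDer z lam t * twist z lam κ a t) t := by
  filter_upwards [eventually_weight_div_mem_slitPlane z lam ha, eventually_ne_singular z ha]
    with t h1 h2
  have h := ((((hasDerivAt_weight z lam h2).div_const (weight z lam a)).clog h1).const_mul κ).cexp
  refine h.congr_deriv ?_
  have e1 := weight_ne_zero z lam h2
  have e2 := weight_ne_zero z lam ha
  rw [twist]
  field_simp

lemma analyticAt_twist (κ : ℂ) {a : ℂ} (ha : ∀ i, a ≠ z i) : AnalyticAt ℂ (twist z lam κ a) a :=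
  Complex.analyticAt_iff_eventually_differentiableAt.mpr
    ((eventually_hasDerivAt_twist z lam κ ha).mono fun _ h => h.differentiableAt)

lemma eventually_deriv_twist_mul (κ : ℂ) {a : ℂ} (ha : ∀ i, a ≠ z i) {u : ℂ → ℂ}
    (hu : AnalyticAt ℂ u a) :
    ∀ᶠ t in 𝓝 a, deriv (fun t => twist z lam κ a t * u t) t
        = twist z lam κ a t * (deriv u t + κ * logDer z lam t * u t) ∧
      deriv (deriv fun t => twist z lam κ a t * u t) t
        = twist z lam κ a t * (deriv (deriv u) t + 2 * κ * logDer z lam t * deriv u t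
          + (κ ^ 2 * logDer z lam t ^ 2 - κ * ∑ j, (lam j : ℂ) / (t - z j) ^ 2) * u t) := by
  have h1 : ∀ᶠ t in 𝓝 a, deriv (fun t => twist z lam κ a t * u t) t
        = twist z lam κ a t * (deriv u t + κ * logDer z lam t * u t) := by
    filter_upwards [eventually_hasDerivAt_twist z lam κ ha, hu.eventually_analyticAt] with t h1 h2
    refine (h1.mul h2.differentiableAt.hasDerivAt).deriv.trans ?_
    ring
  filter_upwards [h1, Filter.EventuallyEq.deriv h1, eventually_hasDerivAt_twist z lam κ ha,
    hu.eventually_analyticAt, eventually_ne_singular z ha] with t e1 e2 h3 h4 h5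
  refine ⟨e1, ?_⟩
  rw [e2]
  have h := h3.mul (h4.deriv.differentiableAt.hasDerivAt.add
    (((hasDerivAt_logDer z lam h5).const_mul κ).mul h4.differentiableAt.hasDerivAt))
  refine h.deriv.trans ?_
  simp only [Pi.add_apply, Pi.mul_apply]
  ring

lemma isSolutionAt_twist_mul (hz : Function.Injective z) {a : ℂ} (ha : ∀ i, a ≠ z i) {g : ℂ → ℂ}
    (hg : IsODESolutionAt (nodal z) (firstCoeff z lam) (zerothCoeff z lam μ) g a) :
    IsSolutionAt (potential z lam μ) (fun t => twist z lam (-(1 / 2)) a t * g t) a := by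
  refine ⟨(analyticAt_twist z lam _ ha).mul hg.1, ?_⟩
  filter_upwards [eventually_deriv_twist_mul z lam (-(1 / 2)) ha hg.1, hg.2,
    eventually_ne_singular z ha] with t h1 h2 h3
  rw [h1.2, potential_eq z lam μ hz h3]
  rw [eval_firstCoeff z lam h3, eval_zerothCoeff z lam μ h3, mul_assoc, mul_assoc, ← mul_add] at h2
  rw [mul_left_cancel₀ (eval_nodal_ne_zero z h3) h2]
  ring

lemma isODESolutionAt_twist_mul (hz : Function.Injective z) {a : ℂ} (ha : ∀ i, a ≠ z i)
    {φ : ℂ → ℂ} (hφ : IsSolutionAt (potential z lam μ) φ a) :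
    IsODESolutionAt (nodal z) (firstCoeff z lam) (zerothCoeff z lam μ)
      (fun t => twist z lam (1 / 2) a t * φ t) a := by
  refine ⟨(analyticAt_twist z lam _ ha).mul hφ.1, ?_⟩
  filter_upwards [eventually_deriv_twist_mul z lam (1 / 2) ha hφ.1, hφ.2,
    eventually_ne_singular z ha] with t h1 h2 h3
  rw [h1.1, h1.2, h2, potential_eq z lam μ hz h3, eval_firstCoeff z lam h3,
    eval_zerothCoeff z lam μ h3]
  ring

/-- For the eigenvalues of the Gaudin Hamiltonians, the equation has no logarithmic solutions. -/
theorem hasRegularPair_gaudin (hz : Function.Injective z)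
    (hΨ : ∃ Ψ : States lam, Ψ ≠ 0 ∧ ∀ i, hamiltonian z lam i Ψ = μ i • Ψ) (b : ℂ) :
    HasRegularPair (nodal z) (firstCoeff z lam) (zerothCoeff z lam μ) b := by
  by_cases hb : ∀ i, b ≠ z i
  · exact hasRegularPair_of_ne_zero b (eval_nodal_ne_zero z hb)
  · push Not at hb
    obtain ⟨i, rfl⟩ := hb
    obtain ⟨p, hp0, hp⟩ := exists_truncated_solution z lam hz μ hΨ i
    have hne : (nodalErase z i).eval (z i) ≠ 0 := by
      rw [nodalErase, eval_prod, Finset.prod_ne_zero_iff]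
      intro j hj
      simpa [sub_eq_zero] using hz.ne (Finset.ne_of_mem_erase hj).symm
    have hd : (derivative (nodal z)).eval (z i) = (nodalErase z i).eval (z i) := by
      rw [nodal_eq z i]
      simp
    refine hasRegularPair_of_truncated (z i) (lam i) ?_ (hd ▸ hne) ?_ p hp0 hp
    · rw [nodal_eq z i]
      simp
    · rw [hd, firstCoeff, eval_finsetSum, Finset.sum_eq_single i]
      · simp
      · intro j _ hj
        rw [eval_mul, nodalErase, eval_prod, Finset.prod_eq_zero (i := i) (by simp [hj.symm])
          (by simp), mul_zero]
      · simp

end Potential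

/-! ### Analytic continuation -/

section Continuation

variable {N : ℕ} {z : Fin N → ℂ}

lemma IsSolutionAt.const_mul {q φ : ℂ → ℂ} {a : ℂ} (h : IsSolutionAt q φ a) (c : ℂ) :
    IsSolutionAt q (fun t => c * φ t) a := by
  refine ⟨analyticAt_const.mul h.1, ?_⟩
  have h1 : deriv (fun t => c * φ t) = fun t => c * deriv φ t :=
    funext fun t => deriv_const_mul_field c
  filter_upwards [h.2] with t ht
  rw [h1, deriv_const_mul_field, ht]
  ring

/-- The continuation of a germ along a path is unique. -/
lemma IsContinuation.unique {q : ℂ → ℂ} {a b : Punctured z} {γ : Path a b}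
    {F G : unitInterval → ℂ → ℂ} (hF : IsContinuation q γ F) (hG : IsContinuation q γ G)
    (h0 : F 0 =ᶠ[𝓝 (a : ℂ)] G 0) : F 1 =ᶠ[𝓝 (b : ℂ)] G 1 := by
  have hγ : Continuous fun s => (γ s : ℂ) := continuous_subtype_val.comp γ.continuous
  set S : Set unitInterval := {s | F s =ᶠ[𝓝 (γ s : ℂ)] G s} with hS
  have hopen : IsOpen S := by
    rw [isOpen_iff_mem_nhds]
    intro s hs
    filter_upwards [hF.2 s, hG.2 s, hγ.continuousAt.eventually (Filter.Eventually.eventually_nhds hs)]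
      with s' h1 h2 h3
    exact (h1.trans h3).trans h2.symm
  have hclosed : IsOpen Sᶜ := by
    rw [isOpen_iff_mem_nhds]
    intro s hs
    have han : ∀ᶠ t in 𝓝 (γ s : ℂ), AnalyticAt ℂ (F s) t ∧ AnalyticAt ℂ (G s) t :=
      (hF.1 s).1.eventually_analyticAt.and (hG.1 s).1.eventually_analyticAt
    obtain ⟨ε, hε, hball⟩ := Metric.eventually_nhds_iff_ball.mp han
    filter_upwards [hF.2 s, hG.2 s, hγ.continuousAt.eventually (Metric.ball_mem_nhds _ hε)]
      with s' h1 h2 h3 h4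
    refine hs ?_
    have heq := AnalyticOnNhd.eqOn_of_preconnected_of_eventuallyEq
      (fun t ht => (hball t ht).1) (fun t ht => (hball t ht).2)
      (convex_ball _ ε).isPreconnected h3 ((h1.symm.trans h4).trans h2)
    filter_upwards [Metric.ball_mem_nhds _ hε] with t ht using heq ht
  have h0S : (0 : unitInterval) ∈ S := by
    simpa [hS] using h0
  have huniv : S = Set.univ := by
    rcases isClopen_iff.mp ⟨⟨hclosed⟩, hopen⟩ with h | h
    · exact absurd (h ▸ h0S) (Set.notMem_empty _)
    · exact h
  have h1S : (1 : unitInterval) ∈ S := huniv ▸ Set.mem_univ _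
  simpa [hS] using h1S

/-- The bound `π / 2` lets two such logarithms be added without leaving the principal strip. -/
lemma arg_lt_of_near_one {f : ℂ → ℂ} {a : ℂ} (hf : ContinuousAt f a) (h1 : f a = 1) :
    ∀ᶠ t in 𝓝 a, |(Complex.log (f t)).im| < Real.pi / 2 := by
  have hc : ContinuousAt (fun t => |(Complex.log (f t)).im|) a := by
    have : ContinuousAt (fun t => Complex.log (f t)) a :=
      hf.clog (h1 ▸ Complex.one_mem_slitPlane)
    exact (Complex.continuous_im.continuousAt.comp this).abs
  refine hc.eventually_lt continuousAt_const ?_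
  rw [h1]
  simpa using Real.pi_pos

variable (lam : Fin N → ℕ) (μ : Fin N → ℂ)

/-- A continuous logarithm of the weight along a loop determines the monodromy. -/
theorem hasScalarMonodromy_of_log (hz : Function.Injective z)
    (hreg : ∀ b, HasRegularPair (nodal z) (firstCoeff z lam) (zerothCoeff z lam μ) b)
    {a : Punctured z} (γ : Path a a) (ℓ : unitInterval → ℂ) (hℓ : Continuous ℓ)
    (hexp : ∀ s, Complex.exp (ℓ s) = weight z lam (γ s)) :
    HasScalarMonodromy (potential z lam μ) γ (Complex.exp (-(ℓ 1 - ℓ 0) / 2)) := by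
  intro φ hφ
  have hγ : Continuous fun s => (γ s : ℂ) := continuous_subtype_val.comp γ.continuous
  obtain ⟨M, hM0, hM⟩ : ∃ M : ℝ, 0 < M ∧ ∀ s, ‖(γ s : ℂ)‖ < M := by
    obtain ⟨M, hM⟩ := (isCompact_range hγ).isBounded.exists_norm_le
    refine ⟨M + 1, ?_, fun s => ?_⟩
    · have := hM _ ⟨0, rfl⟩
      linarith [norm_nonneg (γ 0 : ℂ)]
    · linarith [hM _ ⟨s, rfl⟩]
  -- The square contains the whole loop, and on it the untwisted solution is a single holomorphic
  -- function `G`, even across the singular points.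
  set U : Set ℂ := Set.Ioo (-M) M ×ℂ Set.Ioo (-M) M with hU
  have hγU : ∀ s, (γ s : ℂ) ∈ U := by
    intro s
    rw [hU, Complex.mem_reProdIm, Set.mem_Ioo, Set.mem_Ioo, ← abs_lt, ← abs_lt]
    exact ⟨(Complex.abs_re_le_norm _).trans_lt (hM s), (Complex.abs_im_le_norm _).trans_lt (hM s)⟩
  have haU : (a : ℂ) ∈ U := by simpa using hγU 0
  have hg := isODESolutionAt_twist_mul z lam μ hz a.2 hφ
  obtain ⟨G, hG, hGa⟩ := extendsOn_square (nodal_ne_zero z) hreg M hM0 (a : ℂ) haU _ hg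
  have hGsol : ∀ s, IsODESolutionAt (nodal z) (firstCoeff z lam) (zerothCoeff z lam μ) G (γ s) :=
    fun s => (hg.congr hGa.symm).of_preconnected (isOpen_rect _ _ _ _)
      (isPreconnected_rect _ _ _ _) hG haU (hγU s)
  -- The twist at `γ s` is normalized to be `1` there; the exponential prefactor restores the branch
  -- of `weight^(-1/2)` carried along the path.
  set F : unitInterval → ℂ → ℂ := fun s t =>
    Complex.exp (-(ℓ s - ℓ 0) / 2) * (twist z lam (-(1 / 2)) (γ s) t * G t) with hF
  have hcont : IsContinuation (potential z lam μ) γ F := by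
    refine ⟨fun s => (isSolutionAt_twist_mul z lam μ hz (γ s).2 (hGsol s)).const_mul _, fun s => ?_⟩
    have h1 : ∀ᶠ s' in 𝓝 s, |(ℓ s' - ℓ s).im| < Real.pi / 2 := by
      have hc : Continuous fun s' => |(ℓ s' - ℓ s).im| := by fun_prop
      refine hc.continuousAt.eventually_lt continuousAt_const ?_
      simpa using Real.pi_pos
    filter_upwards [h1] with s' h1
    have h2 := arg_lt_of_near_one (a := (γ s' : ℂ))
      (f := fun t => weight z lam t / weight z lam (γ s'))
      ((continuous_weight z lam).continuousAt.div_const _)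
      (div_self (weight_ne_zero z lam (γ s').2))
    filter_upwards [h2, eventually_ne_singular z (γ s').2] with t h2 h3
    have hw := weight_ne_zero z lam (γ s').2
    -- Both imaginary parts on the right are below `π / 2` in absolute value, so the sum is the
    -- principal logarithm and the two branches agree.
    have hlog : Complex.log (weight z lam t / weight z lam (γ s))
        = (ℓ s' - ℓ s) + Complex.log (weight z lam t / weight z lam (γ s')) := by
      rw [abs_lt] at h1 h2
      rw [← Complex.log_exp (x := (ℓ s' - ℓ s)
        + Complex.log (weight z lam t / weight z lam (γ s')))]
      · rw [Complex.exp_add, Complex.exp_sub, hexp, hexp, Complex.exp_log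
          (div_ne_zero (weight_ne_zero z lam h3) hw)]
        congr 1
        field_simp
      · rw [Complex.add_im]
        linarith [h1.1, h2.1]
      · rw [Complex.add_im]
        linarith [h1.2, h2.2]
    simp only [hF, twist, hlog]
    rw [← mul_assoc, ← mul_assoc, ← Complex.exp_add, ← Complex.exp_add]
    congr 2
    ring
  have hφG : (fun t => twist z lam (-(1 / 2)) a t * G t) =ᶠ[𝓝 (a : ℂ)] φ := by
    filter_upwards [hGa] with t ht
    rw [ht, ← mul_assoc, mul_comm (twist _ _ _ _ _), twist_mul_twist, one_mul]
  have h0 : F 0 =ᶠ[𝓝 (a : ℂ)] φ := by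
    filter_upwards [hφG] with t ht
    simpa [hF] using ht
  have h1 : F 1 =ᶠ[𝓝 (a : ℂ)] fun t => Complex.exp (-(ℓ 1 - ℓ 0) / 2) * φ t := by
    filter_upwards [hφG] with t ht
    simp only [hF, Path.target, ht]
  refine ⟨⟨F, hcont, h0⟩, fun F' hF' h0' => ?_⟩
  exact (hF'.unique hcont (h0'.trans h0.symm)).trans h1

/-- The monodromy along a loop with continuous logarithms of all `t - zⱼ` along it. -/
lemma hasScalarMonodromy_of_logs (hz : Function.Injective z)
    (hreg : ∀ b, HasRegularPair (nodal z) (firstCoeff z lam) (zerothCoeff z lam μ) b)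
    {a : Punctured z} (γ : Path a a) (ℓ : Fin N → unitInterval → ℂ) (hℓ : ∀ j, Continuous (ℓ j))
    (hexp : ∀ j s, Complex.exp (ℓ j s) = γ s - z j) :
    HasScalarMonodromy (potential z lam μ) γ
      (Complex.exp (-(∑ j, lam j * (ℓ j 1 - ℓ j 0)) / 2)) := by
  have h := hasScalarMonodromy_of_log lam μ hz hreg γ (fun s => ∑ j, lam j * ℓ j s)
    (by fun_prop) (fun s => by
      rw [Complex.exp_sum, weight]
      exact Finset.prod_congr rfl fun j _ => by rw [Complex.exp_nat_mul, hexp])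
  simpa only [← Finset.sum_sub_distrib, ← mul_sub] using h

lemma exp_half_period (n : ℕ) :
    Complex.exp (-(n * (2 * Real.pi * Complex.I)) / 2) = (-1) ^ n := by
  rw [← Complex.exp_neg_pi_mul_I, ← Complex.exp_nat_mul]
  congr 1
  ring

lemma exp_half_period_neg (n : ℕ) :
    Complex.exp (-(n * -(2 * Real.pi * Complex.I)) / 2) = (-1) ^ n := by
  rw [← Complex.exp_pi_mul_I, ← Complex.exp_nat_mul]
  congr 1
  ring

lemma norm_exp_circle (s : ℝ) : ‖Complex.exp (2 * Real.pi * Complex.I * (s : ℂ))‖ = 1 := by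
  have : (2 * Real.pi * Complex.I * (s : ℂ)) = ((2 * Real.pi * s : ℝ) : ℂ) * Complex.I := by
    push_cast
    ring
  rw [this, Complex.norm_exp_ofReal_mul_I]

theorem hasScalarMonodromy_around (hz : Function.Injective z)
    (hreg : ∀ b, HasRegularPair (nodal z) (firstCoeff z lam) (zerothCoeff z lam μ) b)
    (i : Fin N) {a : Punctured z} (γ : Path a a) (hγ : IsLoopAround i γ) :
    HasScalarMonodromy (potential z lam μ) γ ((-1) ^ lam i) := by
  obtain ⟨w, hw, hsep, hcirc⟩ := hγ
  set e : unitInterval → ℂ := fun s => Complex.exp (2 * Real.pi * Complex.I * ((s : ℝ) : ℂ)) with he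
  have hec : Continuous e := by fun_prop
  have hlt : ∀ j, j ≠ i → ∀ s, ‖w * e s / (z i - z j)‖ < 1 := by
    intro j hj s
    rw [norm_div, norm_mul, he, norm_exp_circle, mul_one, norm_sub_rev,
      div_lt_one (norm_pos_iff.mpr (sub_ne_zero.mpr (hz.ne hj)))]
    exact hsep j hj
  -- Only `t - zᵢ` winds. For `j ≠ i`, `t - zⱼ` equals `zᵢ - zⱼ` times a number within distance less
  -- than `1` of `1`, whose principal logarithm is continuous and returns to its initial value.
  have h := hasScalarMonodromy_of_logs lam μ hz hreg γ
    (fun j s => if j = i then Complex.log w + 2 * Real.pi * Complex.I * ((s : ℝ) : ℂ)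
      else Complex.log (z i - z j) + Complex.log (1 + w * e s / (z i - z j)))
    (by
      intro j
      by_cases hj : j = i
      · simp only [hj, if_true]
        fun_prop
      · simp only [hj, if_false]
        refine continuous_const.add (Continuous.clog (by fun_prop) fun s => ?_)
        exact Complex.mem_slitPlane_of_norm_lt_one (hlt j hj s))
    (by
      intro j s
      rw [hcirc s]
      by_cases hj : j = i
      · simp only [hj, if_true]
        rw [Complex.exp_add, Complex.exp_log hw]
        ring
      · simp only [hj, if_false]
        have hne : z i - z j ≠ 0 := sub_ne_zero.mpr (hz.ne (Ne.symm hj))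
        rw [Complex.exp_add, Complex.exp_log hne, Complex.exp_log
          (Complex.slitPlane_ne_zero (Complex.mem_slitPlane_of_norm_lt_one (hlt j hj s)))]
        field_simp
        ring)
  have he1 : e 1 = e 0 := by simp [he]
  convert h using 1
  rw [Finset.sum_eq_single i]
  · rw [← exp_half_period]
    simp
  · intro j _ hj
    simp [hj, he1]
  · simp

theorem hasScalarMonodromy_infty (hz : Function.Injective z)
    (hreg : ∀ b, HasRegularPair (nodal z) (firstCoeff z lam) (zerothCoeff z lam μ) b)
    {a : Punctured z} (γ : Path a a) (hγ : IsLoopAroundInfty γ) :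
    HasScalarMonodromy (potential z lam μ) γ ((-1) ^ ∑ j, lam j) := by
  obtain ⟨c, w, hw, hsep, hcirc⟩ := hγ
  set e : unitInterval → ℂ := fun s =>
    Complex.exp (2 * Real.pi * Complex.I * ((1 - (s : ℝ) : ℝ) : ℂ)) with he
  have hec : Continuous e := by fun_prop
  have he0 : ∀ s, e s ≠ 0 := fun s => Complex.exp_ne_zero _
  have hγs : ∀ s, (γ s : ℂ) = c + w * e s := by
    intro s
    have := hcirc (unitInterval.symm s)
    simpa [Path.symm_apply, he] using this
  have hlt : ∀ j s, ‖(c - z j) / (w * e s)‖ < 1 := by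
    intro j s
    rw [norm_div, norm_mul, he, norm_exp_circle, mul_one, norm_sub_rev,
      div_lt_one (norm_pos_iff.mpr hw)]
    exact hsep j
  -- Here every `t - zⱼ` winds once, clockwise: it is `w * e s` times a number within distance less
  -- than `1` of `1`.
  have h := hasScalarMonodromy_of_logs lam μ hz hreg γ
    (fun j s => Complex.log w + 2 * Real.pi * Complex.I * ((1 - (s : ℝ) : ℝ) : ℂ)
      + Complex.log (1 + (c - z j) / (w * e s)))
    (by
      intro j
      refine Continuous.add (by fun_prop) (Continuous.clog ?_ fun s => ?_)
      · exact continuous_const.add (continuous_const.div (by fun_prop)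
          fun s => mul_ne_zero hw (he0 s))
      · exact Complex.mem_slitPlane_of_norm_lt_one (hlt j s))
    (by
      intro j s
      rw [hγs s, Complex.exp_add, Complex.exp_add, Complex.exp_log hw, Complex.exp_log
        (Complex.slitPlane_ne_zero (Complex.mem_slitPlane_of_norm_lt_one (hlt j s)))]
      change w * e s * (1 + (c - z j) / (w * e s)) = c + w * e s - z j
      have := he0 s
      field_simp
      ring)
  have he1 : e 1 = e 0 := by simp [he]
  convert h using 1
  rw [← exp_half_period_neg, Nat.cast_sum, Finset.sum_mul]
  congr 3
  refine Finset.sum_congr rfl fun j _ => ?_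
  rw [he1]
  simp

/-- The exponential is a covering of `ℂ ∖ {0}`, so the path of values of the weight lifts, for an
arbitrary loop. -/
lemma exists_log_weight {a : Punctured z} (γ : Path a a) :
    ∃ ℓ : unitInterval → ℂ, Continuous ℓ ∧ ∀ s, Complex.exp (ℓ s) = weight z lam (γ s) := by
  have hγ : Continuous fun s => (γ s : ℂ) := continuous_subtype_val.comp γ.continuous
  obtain ⟨Γ, hΓ, -⟩ := Complex.isCoveringMap_exp.exists_path_lifts
    ⟨fun s => ⟨weight z lam (γ s), weight_ne_zero z lam (γ s).2⟩,
      ((continuous_weight z lam).comp hγ).subtype_mk _⟩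
    (Complex.log (weight z lam (γ 0)))
    (Subtype.ext (Complex.exp_log (weight_ne_zero z lam (γ 0).2)).symm)
  exact ⟨Γ, Γ.continuous, fun s => congrArg Subtype.val (congrFun hΓ s)⟩

lemma exists_isFundamentalSystem (hz : Function.Injective z) (a : Punctured z)
    (hreg : HasRegularPair (nodal z) (firstCoeff z lam) (zerothCoeff z lam μ) a) :
    ∃ φ, IsFundamentalSystem (potential z lam μ) a φ := by
  obtain ⟨r, hr, g₀, g₁, -, -, hsol, hind, hspan⟩ := hreg.exists_ball (nodal_ne_zero z)
  have ha : (a : ℂ) ∈ Metric.ball (a : ℂ) r := Metric.mem_ball_self hr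
  refine ⟨![fun t => twist z lam (-(1 / 2)) a t * g₀ t, fun t => twist z lam (-(1 / 2)) a t * g₁ t],
    ?_, ?_, ?_⟩
  · intro k
    fin_cases k
    · exact isSolutionAt_twist_mul z lam μ hz a.2 (hsol a ha).1
    · exact isSolutionAt_twist_mul z lam μ hz a.2 (hsol a ha).2
  · intro c hc
    obtain ⟨h0, h1⟩ := hind a ha (c 0) (c 1) (by
      filter_upwards [hc] with t ht
      simp only [Fin.sum_univ_two, Matrix.cons_val_zero, Matrix.cons_val_one] at ht
      refine (mul_eq_zero.mp ?_).resolve_left (twist_ne_zero z lam (-(1 / 2)) a t)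
      linear_combination ht)
    ext k
    fin_cases k
    · exact h0
    · exact h1
  · intro ψ hψ
    obtain ⟨c₀, c₁, hc⟩ := hspan a ha _ (isODESolutionAt_twist_mul z lam μ hz a.2 hψ)
    refine ⟨![c₀, c₁], ?_⟩
    filter_upwards [hc] with t ht
    simp only [Fin.sum_univ_two, Matrix.cons_val_zero, Matrix.cons_val_one]
    have h1 := twist_mul_twist z lam (1 / 2) a t
    linear_combination twist z lam (-(1 / 2)) a t * ht - ψ t * h1

/-- A scalar monodromy has a scalar matrix in every basis, and scalar matrices form the centre of
`GL₂`. -/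
lemma isProjectiveMonodromy_one {q : ℂ → ℂ} {a : Punctured z} {φ : Fin 2 → ℂ → ℂ}
    (hφ : IsFundamentalSystem q a φ)
    (h : ∀ γ : Path a a, ∃ ε : ℂ, ε ≠ 0 ∧ HasScalarMonodromy q γ ε) :
    IsProjectiveMonodromy q a φ 1 := by
  intro γ
  obtain ⟨ε, hε, hmon⟩ := h γ
  refine ⟨Matrix.GeneralLinearGroup.scalar (Fin 2) (Units.mk0 ε hε), fun l => ?_, ?_⟩
  · obtain ⟨⟨F, hF, hF0⟩, hall⟩ := hmon (φ l) (hφ.isSolutionAt l)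
    refine ⟨F, hF, hF0, (hall F hF hF0).trans (Filter.Eventually.of_forall fun t => ?_)⟩
    fin_cases l <;> simp [Fin.sum_univ_two]
  · rw [MonoidHom.one_apply, eq_comm, QuotientGroup.eq_one_iff,
      Matrix.GeneralLinearGroup.center_eq_range_scalar]
    exact ⟨_, rfl⟩

end Continuation

end Gaudin

end

/-! ### The main theorem -/

theorem mainTheorem2 {N : ℕ} (z : Fin N → ℂ) (hz : Function.Injective z)
    (lam : Fin N → ℕ) (μ : Fin N → ℂ)
    (hΨ : ∃ Ψ : Gaudin.States lam, Ψ ≠ 0 ∧ ∀ i, Gaudin.hamiltonian z lam i Ψ = μ i • Ψ) :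
    (∀ i, ∃ ε : ℂ, (ε = 1 ∨ ε = -1) ∧
      ∀ (a : Gaudin.Punctured z) (γ : Path a a), Gaudin.IsLoopAround i γ →
        Gaudin.HasScalarMonodromy (Gaudin.potential z lam μ) γ ε) ∧
    (∃ ε : ℂ, (ε = 1 ∨ ε = -1) ∧
      ∀ (a : Gaudin.Punctured z) (γ : Path a a), Gaudin.IsLoopAroundInfty γ →
        Gaudin.HasScalarMonodromy (Gaudin.potential z lam μ) γ ε) ∧
    (∀ a : Gaudin.Punctured z,
      (∃ φ, Gaudin.IsFundamentalSystem (Gaudin.potential z lam μ) a φ) ∧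
      ∀ φ, Gaudin.IsFundamentalSystem (Gaudin.potential z lam μ) a φ →
        Gaudin.IsProjectiveMonodromy (Gaudin.potential z lam μ) a φ 1) := by
  have hreg := Gaudin.hasRegularPair_gaudin z lam μ hz hΨ
  refine ⟨fun i => ⟨(-1) ^ lam i, neg_one_pow_eq_or ℂ _, fun a γ hγ =>
      Gaudin.hasScalarMonodromy_around lam μ hz hreg i γ hγ⟩,
    ⟨(-1) ^ ∑ j, lam j, neg_one_pow_eq_or ℂ _, fun a γ hγ =>
      Gaudin.hasScalarMonodromy_infty lam μ hz hreg γ hγ⟩,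
    fun a => ⟨Gaudin.exists_isFundamentalSystem lam μ hz a (hreg a), fun φ hφ =>
      Gaudin.isProjectiveMonodromy_one hφ fun γ => ?_⟩⟩
  -- For a general loop only the scalarity of the monodromy matters, so any continuous logarithm of
  -- the weight suffices.
  obtain ⟨ℓ, hℓ, hexp⟩ := Gaudin.exists_log_weight lam γ
  exact ⟨_, Complex.exp_ne_zero _, Gaudin.hasScalarMonodromy_of_log lam μ hz hreg γ ℓ hℓ hexp⟩
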